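/- **Setting.** Let $G=(V,E)$ be a finite simple connected graph with $n=|V|$ nodes. A set $C\subseteq V$ is (geodesically) convex if it contains all nodes of every shortest path between any two of its members; $I(a,b)$ denotes the set of nodes lying on at least one shortest path from $a$ to $b$. A $k$-labeling $y:V\to[k]$ is convex if each cluster $\{v: y(v)=i\}$ is convex. The Hadwiger number $h(G)$ is the largest $w$ such that the complete graph $K_w$ is a minor of $G$. In self-directed learning, the learner knows $G$ and $k$ but not $y$; in each trial it selects a node $v$ not selected before, predicts a label $\hat y(v)\in[k]$, then observes $y(v)$, and makes a mistake iff $\hat y(v)\ne y(v)$. A *quadruple* in $S\subseteq V$ is an unordered pair $\{(a,b),(c,d)\}$ of unordered pairs, where $a,b,c,d\in S$ are distinct; it is *good* if $I(a,b)\cap I(c,d)\neq\emptyset$. Let $Q(S)$ and $Q_{\rm good}(S)$ be the sets of quadruples and of good quadruples in $S$. **The algorithm.** "Learning" a node means: if its label is still unknown, predict for it and observe its label. $\mathrm{FindDistinctLabel}(G,S,Z)$, for a set of nodes $S$ and a non-empty set of labels $Z$, returns a node or $-1$: - If $Z=\{z\}$: go through the nodes $a'\in S$, learning $a'$ with prediction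 $z$; as soon as $y(a')\neq z$, return $a'$. If this never happens, return $-1$. - Otherwise put $\epsilon=|Q_{\rm good}(S)|/(8|Q(S)|)$ (with $0/0=0$); if $S=\emptyset$, return $-1$. Let $a\in S$ be a node contained in the most good quadruples in $S$; learn $a$ with a prediction from $Z$. If $y(a)\notin Z$, return $a$. - Let $Y_a$ be the set of $b'\in S$ such that $\{(a,b'),(c,d)\}$ is good for at least $\lceil 2\epsilon(|S|-2)(|S|-3)\rceil$ unordered pairs $(c,d)$ in $S$. Let $b=\mathrm{FindDistinctLabel}(G,Y_a,Z\setminus\{y(a)\})$. If $b=-1$, return $-1$; if $y(b)\ne y(a)$, return $b$. - Let $Y_{ab}$ be the set of $c'\in S$ such that $\{(a,b),(c',d)\}$ is good for at least $\lceil\epsilon(|S|-3)\rceil$ nodes $d\in S$. Let $c=\mathrm{FindDistinctLabel}(G,Y_{ab},\{y(a)\})$. If $c=-1$, return $-1$; if $y(c)\notin Z$, return $c$. - Let $Y_{abc}$ be the set of $d'\in S$ such that $\{(a,b),(c,d')\}$ is good. Let $d=\mathrm{FindDistinctLabel}(G,Y_{abc},Z\setminus\{y(c)\})$. If $d=-1$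 or $y(d)=y(c)$, return $-1$; otherwise return $d$. *Multiclass-Good4* starts with $U=V$; while $Q_{\rm good}(U)\ne\emptyset$, it calls $\mathrm{FindDistinctLabel}(G,U,[k])$ and then removes from $U$ all nodes with known labels. Finally it learns all nodes remaining in $U$ with arbitrary predictions. (Ties and arbitrary predictions are resolved by taking the first candidate in the given order of nodes and labels, which may be any order of the nodes and is $1,\dots,k$ for the labels. Running time is counted in elementary steps: edge queries, comparisons of nodes or labels, predictions, arithmetic operations, and visiting or creating a list cell.) **Theorem.** There are absolute constants $C,c\in\mathbb N$ such that for every $k$, every finite simple connected graph $G$ with $n$ nodes and every convex $k$-labeling $y$ of $G$, Multiclass-Good4 1. selects every node in exactly one trial and outputs the labels $y(v)$ of all nodes $v$; 2. takes at most $C^k n^{c}$ steps; 3. if $n\ge2$, makes at most $C^k\cdot 2^k\,h(G)^{4k}\ln n$ mistakes. In particular, for constant $k$, it restores all labels in time polynomial in $n$ and with $O(2^k h(G)^{4k}\ln n)$ mistakes. -/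

import Mathlib

/-! ### Graph notions -/

/-- The geodesic interval `I(a, b)`: all nodes lying on at least one shortest path from `a` to `b`. -/
def geodesicInterval {V : Type} (G : SimpleGraph V) (a b : V) : Set V :=
  {v | ∃ p : G.Walk a b, p.length = G.dist a b ∧ v ∈ p.support}

/-- A set of nodes is (geodesically) convex if it contains every shortest path between any two
of its members. -/
def IsGeodesicallyConvex {V : Type} (G : SimpleGraph V) (C : Set V) : Prop :=
  ∀ a ∈ C, ∀ b ∈ C, geodesicInterval G a b ⊆ C

/-- A labeling is convex if each of its clusters `{v | y v = i}` is convex. -/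
def IsConvexLabeling {V L : Type} (G : SimpleGraph V) (y : V → L) : Prop :=
  ∀ i : L, IsGeodesicallyConvex G {v | y v = i}

/-- `H` is a minor of `G`: the nodes of `H` can be represented by pairwise disjoint connected
(in particular non-empty) branch sets of `G`, with an edge of `G` between the branch sets of
any two adjacent nodes of `H`. Contracting the branch sets and deleting everything else yields `H`. -/
def IsGraphMinor {W V : Type} (H : SimpleGraph W) (G : SimpleGraph V) : Prop :=
  ∃ B : W → Set V,
    (∀ i, (G.induce (B i)).Connected) ∧
    (∀ i j, i ≠ j → Disjoint (B i) (B j)) ∧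
    (∀ i j, H.Adj i j → ∃ u ∈ B i, ∃ v ∈ B j, G.Adj u v)

/-- The Hadwiger number: the size of the largest clique minor. -/
noncomputable def hadwigerNumber {V : Type} (G : SimpleGraph V) : ℕ :=
  sSup {w : ℕ | IsGraphMinor (⊤ : SimpleGraph (Fin w)) G}

/-! ### Self-directed learners with a step count

A learner is a program with nodes of type `V` and labels of type `L`. The programs below are
written for arbitrary `V` and `L`, so that everything they can learn about nodes, edges and labels
comes from the instructions listed here. Every instruction costs one step. -/

/-- Programs returning a value of type `α`. -/
inductive Prog (V L α : Type) : Type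
  /-- Halt with a result. -/
  | done (a : α) : Prog V L α
  /-- One elementary internal step (visiting or creating a list cell, an arithmetic test, ...). -/
  | tick (next : Prog V L α) : Prog V L α
  /-- Is `{u, v}` an edge of the input graph? -/
  | adj (u v : V) (next : Bool → Prog V L α) : Prog V L α
  /-- Are the two nodes equal? -/
  | eqNode (u v : V) (next : Bool → Prog V L α) : Prog V L α
  /-- Are the two labels equal? -/
  | eqLabel (i j : L) (next : Bool → Prog V L α) : Prog V L α
  /-- One trial: select node `v`, predict label `i`, and observe the true label of `v`. -/
  | predict (v : V) (i : L) (next : L → Prog V L α) : Prog V L α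

namespace Prog

/-- Sequential composition. -/
def seq {V L α β : Type} : Prog V L α → (α → Prog V L β) → Prog V L β
  | done a, f => f a
  | tick p, f => tick (seq p f)
  | adj u v p, f => adj u v fun b => seq (p b) f
  | eqNode u v p, f => eqNode u v fun b => seq (p b) f
  | eqLabel i j p, f => eqLabel i j fun b => seq (p b) f
  | predict v i p, f => predict v i fun j => seq (p j) f

instance (V L : Type) : Monad (Prog V L) where
  pure := done
  bind := seq

end Prog

/-- What an execution of a program produces: its result, the number of steps it took, and the
list of its trials (selected node, predicted label), in order. -/
structure Execution (V L α : Type) where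
  result : α
  steps : ℕ
  trials : List (V × L)

namespace Execution

/-- Prepend one step without a trial. -/
def addStep {V L α : Type} (e : Execution V L α) : Execution V L α :=
  { e with steps := e.steps + 1 }

/-- Prepend one step that consists of the trial `t`. -/
def addTrial {V L α : Type} (t : V × L) (e : Execution V L α) : Execution V L α :=
  { e with steps := e.steps + 1, trials := t :: e.trials }

/-- The number of mistakes: trials in which the predicted label is not the true one. -/
def mistakes {V L α : Type} [DecidableEq L] (y : V → L) (e : Execution V L α) : ℕ :=
  e.trials.countP fun t => decide (t.2 ≠ y t.1)

end Execution

/-- Execute a program on the graph `G` with the (hidden) labeling `y`. -/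
def Prog.exec {V L α : Type} [DecidableEq V] [DecidableEq L] (G : SimpleGraph V)
    [DecidableRel G.Adj] (y : V → L) : Prog V L α → Execution V L α
  | .done a => ⟨a, 0, []⟩
  | .tick p => (p.exec G y).addStep
  | .adj u v p => ((p (decide (G.Adj u v))).exec G y).addStep
  | .eqNode u v p => ((p (decide (u = v))).exec G y).addStep
  | .eqLabel i j p => ((p (decide (i = j))).exec G y).addStep
  | .predict v i p => ((p (y v)).exec G y).addTrial (v, i)

/-! ### Basic subroutines

Sets are represented by lists. Each subroutine pays at least one step for every list cell that it
visits or creates. -/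

namespace Prog

variable {V L α : Type}

def askAdj (u v : V) : Prog V L Bool := .adj u v .done

def askEqNode (u v : V) : Prog V L Bool := .eqNode u v .done

def askEqLabel (i j : L) : Prog V L Bool := .eqLabel i j .done

def askLabel (v : V) (guess : L) : Prog V L L := .predict v guess .done

/-- Evaluate an arithmetic expression or test, in one step. -/
def compute (a : α) : Prog V L α := .tick (.done a)

/-- Is there a member of the list that passes the test `f`? -/
def existsIn (f : α → Prog V L Bool) : List α → Prog V L Bool
  | [] => compute false
  | x :: xs => .tick do
      if ← f x then pure true else existsIn f xs

/-- The members of the list that pass the test `f`. -/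
def filterIn (f : α → Prog V L Bool) : List α → Prog V L (List α)
  | [] => compute []
  | x :: xs => .tick do
      let b ← f x
      let rest ← filterIn f xs
      pure (if b then x :: rest else rest)

/-- The number of members of the list. -/
def size : List α → Prog V L ℕ
  | [] => compute 0
  | _ :: xs => .tick do
      let m ← size xs
      pure (m + 1)

/-- The number of members of the list that pass the test `f`. -/
def countIn (f : α → Prog V L Bool) (l : List α) : Prog V L ℕ := do
  let l' ← filterIn f l
  size l'

/-- Prepend to `acc` all pairs `(x, x')` with `x'` in the list. -/
def pairsWith (x : α) (acc : List (α × α)) : List α → Prog V L (List (α × α))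
  | [] => compute acc
  | x' :: xs => .tick do
      let rest ← pairsWith x acc xs
      pure ((x, x') :: rest)

/-- All unordered pairs of distinct members of a (duplicate-free) list; each of them is listed
once, as `(x, x')` with `x` before `x'`. -/
def pairsOf : List α → Prog V L (List (α × α))
  | [] => compute []
  | x :: xs => .tick do
      let rest ← pairsOf xs
      pairsWith x rest xs

/-- Is the node `v` in the list? -/
def memNode (v : V) (l : List V) : Prog V L Bool := existsIn (fun x => askEqNode x v) l

/-- Is the label `i` in the list? -/
def memLabel (i : L) (Z : List L) : Prog V L Bool := existsIn (fun j => askEqLabel j i) Z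

/-- The label set `Z \ {i}`. -/
def removeLabel (i : L) (Z : List L) : Prog V L (List L) :=
  filterIn (fun j => do
    let b ← askEqLabel j i
    pure (!b)) Z

/-- Auxiliary loop of `argmax`; `best` is a member with the currently largest value `m`. -/
def argmaxLoop (f : V → Prog V L ℕ) (best : V) (m : ℕ) : List V → Prog V L V
  | [] => compute best
  | x :: xs => .tick do
      let m' ← f x
      if ← compute (decide (m < m')) then argmaxLoop f x m' xs else argmaxLoop f best m xs

/-- A member of the list at which `f` is maximal (`none` for the empty list). -/
def argmax (f : V → Prog V L ℕ) : List V → Prog V L (Option V)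
  | [] => compute none
  | x :: xs => .tick do
      let m ← f x
      let a ← argmaxLoop f x m xs
      pure (some a)

/-! ### Distances and good quadruples; `nodes` lists all nodes of the graph -/

/-- Breadth-first search: if `B` is the ball of radius `i` around some node and `v` is not in it,
go on with the ball of radius `i + 1`. The last list only bounds the number of rounds. -/
def distLoop (nodes : List V) (v : V) (i : ℕ) (B : List V) : List V → Prog V L ℕ
  | [] => compute i
  | _ :: fuel => .tick do
      if ← memNode v B then pure i
      else do
        let B' ← filterIn (fun w => existsIn (fun x => do
          if ← askEqNode x w then pure true else askAdj x w) B) nodes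
        distLoop nodes v (i + 1) B' fuel

/-- The distance of `u` and `v` (in a connected graph). -/
def dist (nodes : List V) (u v : V) : Prog V L ℕ := distLoop nodes v 0 [u] nodes

/-- Is `x` on a shortest path from `a` to `b`? -/
def onShortestPath (nodes : List V) (a b x : V) : Prog V L Bool := do
  let i ← dist nodes a x
  let j ← dist nodes x b
  let m ← dist nodes a b
  compute (decide (i + j = m))

/-- Are the four nodes pairwise distinct? -/
def distinct4 (a b c d : V) : Prog V L Bool := do
  if ← memNode a [b, c, d] then pure false
  else if ← memNode b [c, d] then pure false
  else if ← memNode c [d] then pure false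
  else pure true

/-- Is `{(a, b), (c, d)}` a good quadruple, i.e. are the four nodes distinct and does some shortest
path from `a` to `b` share a node with some shortest path from `c` to `d`? -/
def isGood (nodes : List V) (a b c d : V) : Prog V L Bool := do
  if ← distinct4 a b c d then
    existsIn (fun x => do
      if ← onShortestPath nodes a b x then onShortestPath nodes c d x else pure false) nodes
  else pure false

/-- The set `Q(S)` of all quadruples `{(a, b), (c, d)}` in `S`: unordered pairs of unordered pairs
of four distinct nodes. -/
def quadruples (S : List V) : Prog V L (List ((V × V) × (V × V))) := do
  let P ← pairsOf S
  let PP ← pairsOf P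
  filterIn (fun q => distinct4 q.1.1 q.1.2 q.2.1 q.2.2) PP

/-- The good quadruples among the given ones. -/
def goodQuadruples (nodes : List V) (Q : List ((V × V) × (V × V))) :
    Prog V L (List ((V × V) × (V × V))) :=
  filterIn (fun q => isGood nodes q.1.1 q.1.2 q.2.1 q.2.2) Q

/-- Look up the label of `v` among the labels observed so far. -/
def lookup (v : V) : List (V × L) → Prog V L (Option L)
  | [] => compute none
  | (u, i) :: rest => .tick do
      if ← askEqNode u v then pure (some i) else lookup v rest

end Prog

/-! ### The learner -/

/-- Programs that additionally maintain the list of all labels observed so far. -/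
abbrev Learner (V L : Type) : Type → Type := StateT (List (V × L)) (Prog V L)

namespace Learner

open Prog

variable {V L : Type}

/-- Run a program that does not need the observed labels. -/
def call {α : Type} (p : Prog V L α) : Learner V L α := fun known => do
  let a ← p
  pure (a, known)

/-- The label of `v`. If it is still unknown, predict `guess` for `v` and observe the label. -/
def learn (v : V) (guess : L) : Learner V L L := do
  let known ← get
  match ← call (lookup v known) with
  | some i => pure i
  | none => do
      let i ← call (askLabel v guess)
      set ((v, i) :: known)
      pure i

/-- `FindDistinctLabel(G, S, {z})`: go through the nodes of `S`, predicting `z` for those with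
unknown label, until a node with a label other than `z` shows up. -/
def findOther (z : L) : List V → Learner V L (Option (V × L))
  | [] => call (compute none)
  | a :: S => do
      let ya ← learn a z
      if ← call (askEqLabel ya z) then findOther z S else pure (some (a, ya))

/-- `FindDistinctLabel(G, S, Z)`, where `|Z|` is one more than the first number. A returned node
comes together with its (known) label, and `none` stands for the return value `-1`. Arbitrary
predictions from `Z` are resolved to the first label in `Z`. An empty `S` yields `none`. -/
def findDistinctLabel (nodes : List V) :
    ℕ → List V → List L → Learner V L (Option (V × L))
  | _, _, [] => call (compute none)
  | 0, S, z :: _ => findOther z S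
  | m + 1, S, z :: Z' => do
      let Z := z :: Z'
      let Q ← call (quadruples S)
      let Qgood ← call (goodQuadruples nodes Q)
      let q ← call (size Q)
      let qgood ← call (size Qgood)
      let s ← call (size S)
      let ε : ℚ ← call (compute ((qgood : ℚ) / (8 * q)))
      -- the node `a` that is in most good quadruples
      match ← call (argmax (fun a' =>
          countIn (fun p => memNode a' [p.1.1, p.1.2, p.2.1, p.2.2]) Qgood) S) with
      | none => pure none
      | some a => do
        let ya ← learn a z
        if ← call (memLabel ya Z) then do
          let P ← call (pairsOf S)
          let Ya ← call (filterIn (fun b' => do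
            let N ← countIn (fun p => isGood nodes a b' p.1 p.2) P
            compute (decide (⌈2 * ε * ((s : ℚ) - 2) * ((s : ℚ) - 3)⌉ ≤ (N : ℤ)))) S)
          let Za ← call (removeLabel ya Z)
          match ← findDistinctLabel nodes m Ya Za with
          | none => pure none
          | some (b, yb) => do
            if ← call (askEqLabel yb ya) then do
              let Yab ← call (filterIn (fun c' => do
                let N ← countIn (fun d => isGood nodes a b c' d) S
                compute (decide (⌈ε * ((s : ℚ) - 3)⌉ ≤ (N : ℤ)))) S)
              match ← findOther ya Yab with
              | none => pure none
              | some (c, yc) => do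
                if ← call (memLabel yc Z) then do
                  let Yabc ← call (filterIn (fun d' => isGood nodes a b c d') S)
                  let Zc ← call (removeLabel yc Z)
                  match ← findDistinctLabel nodes m Yabc Zc with
                  | none => pure none
                  | some (d, yd) => do
                    if ← call (askEqLabel yd yc) then pure none else pure (some (d, yd))
                else pure (some (c, yc))
            else pure (some (b, yb))
        else pure (some (a, ya))

/-- The main loop: as long as there are good quadruples in `U`, call `FindDistinctLabel(G, U, Z)`
and remove from `U` all nodes with known labels. Returns the final `U`. Here `|Z| = m + 1`, and the
last list only bounds the number of rounds (every round reveals at least one label, so that as many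
rounds as there are nodes are enough). -/
def mainLoop (nodes : List V) (Z : List L) (m : ℕ) (U : List V) :
    List V → Learner V L (List V)
  | [] => call (compute U)
  | _ :: fuel => do
      let Q ← call (quadruples U)
      match ← call (goodQuadruples nodes Q) with
      | [] => call (compute U)
      | _ :: _ => do
        let _ ← findDistinctLabel nodes m U Z
        let known ← get
        let U' ← call (filterIn (fun v => do
          let o ← lookup v known
          compute o.isNone) U)
        mainLoop nodes Z m U' fuel

/-- Predict the label `z` for all nodes in the list with unknown label. -/
def predictAll (z : L) : List V → Learner V L Unit
  | [] => call (compute ())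
  | v :: U => do
      let _ ← learn v z
      predictAll z U

end Learner

/-- Multiclass-Good4 on a graph with the given list of nodes and for the given list of labels. Its
result is the list of all nodes with their observed labels. -/
def multiclassGood4 {V L : Type} (nodes : List V) (labels : List L) :
    Prog V L (List (V × L)) :=
  match labels with
  | [] => Prog.compute []
  | z :: Z' => do
      let m ← Prog.size Z'
      let (U, known) ← Learner.mainLoop nodes (z :: Z') m nodes nodes []
      let (_, known') ← Learner.predictAll z U known
      pure known'

/-! ### Executions -/

namespace Prog

section Exec

variable {V L α β : Type} [DecidableEq V] [DecidableEq L] (G : SimpleGraph V)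
  [DecidableRel G.Adj] (y : V → L)

/-! Write h for the Hadwiger number and s for the size of the current set S.

Geometry. Any 2h + 2 nodes contain a good quadruple. Otherwise, take h + 1 of them as a_i and h + 1
as b_j: the intervals I(a_i, b_j) and I(a_i', b_j') with i ≠ i' and j ≠ j' never meet, and geodesics
can be cut into the branch sets of a clique minor on h + 1 nodes
(`isGraphMinor_of_disjoint_intervals`). Averaging over the deletion of one node turns existence into
density: if S has a good quadruple at all, at least a fraction 1/(4h)^4 of its quadruples is good
(`le_orderedGoodCount_mul`), so ε ≥ 1/(2048 h^4). A Markov-type count then shows that each of the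
sets Y_a, Y_ab, Y_abc contains at least (ε/4)s nodes (`le_length_firstCandidates` and its two
companions).

Recursion. For |Z| = m + 1, a call either finds a node of S with label outside Z, or leaves at least
δ^m s nodes of S with known labels, where δ = 1/(8192 h^4) is a lower bound for ε/4
(`findDistinctLabel_spec`). Failure is inherited from a subcall on one of the large candidate sets.
The only other way to fail would be to reach a, b with one label and c, d with another while
{(a,b),(c,d)} is good; a common point of the two intervals would then lie in two convex clusters
(`IsConvexLabeling.not_isGoodQuadruple`). The mistakes satisfy T(0) = 1 and T(m+1) = 2T(m) + 2: two
recursive calls, one guess for a, and one scan that stops at its first mistake. Hence T(m) = 3·2^m -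
2.

Main loop. With Z the set of all k = m + 1 labels the first outcome is impossible, so every call
reveals a fraction δ^m of U. There are at most ln(n)/δ^m + 1 rounds, and afterwards at most 2h + 1
nodes remain, each costing at most one mistake (`mainLoop_spec`).

Bookkeeping. `Computes` gives value and cost of trial-free programs; `Spec` also tracks mistakes and
ties the recorded labels to the trials. The recorded nodes are always distinct, which is why no node
is selected twice. -/

theorem exec_seq (p : Prog V L α) (f : α → Prog V L β) :
    (p.seq f).exec G y =
      ⟨((f (p.exec G y).result).exec G y).result,
        (p.exec G y).steps + ((f (p.exec G y).result).exec G y).steps,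
        (p.exec G y).trials ++ ((f (p.exec G y).result).exec G y).trials⟩ := by
  induction p with
  | done a => simp [seq, exec]
  | tick p ih => simp only [seq, exec, Execution.addStep, ih, add_right_comm]
  | adj u v p ih => simp only [seq, exec, Execution.addStep, ih, add_right_comm]
  | eqNode u v p ih => simp only [seq, exec, Execution.addStep, ih, add_right_comm]
  | eqLabel u v p ih => simp only [seq, exec, Execution.addStep, ih, add_right_comm]
  | predict v i p ih => simp only [seq, exec, Execution.addTrial, ih, add_right_comm,
      List.cons_append]

/-- The program `p` makes no trials and returns `a` within `c` steps. -/
structure Computes (p : Prog V L α) (a : α) (c : ℕ) : Prop where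
  result : (p.exec G y).result = a
  steps_le : (p.exec G y).steps ≤ c
  trials : (p.exec G y).trials = []

variable {G y}

/-! ### Values and step counts of the list subroutines -/

namespace Computes

theorem mono {p : Prog V L α} {a : α} {c c' : ℕ} (h : Computes G y p a c) (hc : c ≤ c') :
    Computes G y p a c' :=
  ⟨h.result, h.steps_le.trans hc, h.trials⟩

theorem congr {p : Prog V L α} {a a' : α} {c : ℕ} (h : Computes G y p a c) (ha : a = a') :
    Computes G y p a' c :=
  ha ▸ h

theorem pure (a : α) (c : ℕ) : Computes G y (Pure.pure a : Prog V L α) a c :=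
  ⟨rfl, Nat.zero_le _, rfl⟩

theorem bind {p : Prog V L α} {f : α → Prog V L β} {a : α} {b : β} {c c' : ℕ}
    (h : Computes G y p a c) (h' : Computes G y (f a) b c') :
    Computes G y (p >>= f) b (c + c') := by
  have e := exec_seq G y p f
  change (p >>= f).exec G y = _ at e
  rw [h.result] at e
  exact ⟨by rw [e]; exact h'.result, by rw [e]; exact Nat.add_le_add h.steps_le h'.steps_le,
    by rw [e]; simp [h.trials, h'.trials]⟩

theorem bind_pure {p : Prog V L α} {a : α} {c : ℕ} (h : Computes G y p a c) (g : α → β) :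
    Computes G y (p >>= fun x => Pure.pure (g x)) (g a) c :=
  h.bind (f := fun x => Pure.pure (g x)) (pure _ 0)

theorem tick {p : Prog V L α} {a : α} {c : ℕ} (h : Computes G y p a c) :
    Computes G y (.tick p) a (c + 1) :=
  ⟨h.result, Nat.add_le_add_right h.steps_le 1, h.trials⟩

theorem compute (a : α) : Computes G y (Prog.compute a) a 1 :=
  ⟨rfl, le_rfl, rfl⟩

theorem askAdj (u v : V) : Computes G y (Prog.askAdj u v) (decide (G.Adj u v)) 1 :=
  ⟨rfl, le_rfl, rfl⟩

theorem askEqNode (u v : V) : Computes G y (Prog.askEqNode u v) (decide (u = v)) 1 :=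
  ⟨rfl, le_rfl, rfl⟩

theorem askEqLabel (i j : L) : Computes G y (Prog.askEqLabel i j) (decide (i = j)) 1 :=
  ⟨rfl, le_rfl, rfl⟩

theorem existsIn {f : α → Prog V L Bool} {g : α → Bool} {c : ℕ} {l : List α}
    (h : ∀ x ∈ l, Computes G y (f x) (g x) c) :
    Computes G y (Prog.existsIn f l) (l.any g) (l.length * (c + 1) + 1) := by
  induction l with
  | nil => exact (compute (G := G) (y := y) false).mono (by simp)
  | cons x l ih =>
    have ih' := ih fun z hz => h z (List.mem_cons_of_mem _ hz)
    have hx := h x List.mem_cons_self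
    refine ((hx.bind (b := (x :: l).any g) (c' := l.length * (c + 1) + 1) ?_).tick).mono ?_
    · cases hgx : g x
      · simpa [hgx] using ih'
      · simpa [hgx] using pure (G := G) (y := y) true (l.length * (c + 1) + 1)
    · rw [List.length_cons]; ring_nf; omega

theorem filterIn {f : α → Prog V L Bool} {g : α → Bool} {c : ℕ} {l : List α}
    (h : ∀ x ∈ l, Computes G y (f x) (g x) c) :
    Computes G y (Prog.filterIn f l) (l.filter g) (l.length * (c + 1) + 1) := by
  induction l with
  | nil => exact (compute (G := G) (y := y) []).mono (by simp)
  | cons x l ih =>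
    have ih' := ih fun z hz => h z (List.mem_cons_of_mem _ hz)
    have hx := h x List.mem_cons_self
    refine ((hx.bind (b := (x :: l).filter g)
      ((ih'.bind_pure fun rest => if g x then x :: rest else rest).congr ?_)).tick).mono ?_
    · cases hgx : g x <;> simp [hgx]
    · rw [List.length_cons]; ring_nf; omega

theorem size (l : List α) : Computes G y (Prog.size l) l.length (l.length + 1) := by
  induction l with
  | nil => exact compute _
  | cons x l ih => exact (ih.bind_pure (· + 1)).tick

theorem countIn {f : α → Prog V L Bool} {g : α → Bool} {c : ℕ} {l : List α}
    (h : ∀ x ∈ l, Computes G y (f x) (g x) c) :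
    Computes G y (Prog.countIn f l) (l.countP g) (l.length * (c + 2) + 2) := by
  rw [List.countP_eq_length_filter]
  refine ((filterIn h).bind (size _)).mono ?_
  have := List.length_filter_le g l
  ring_nf; omega

end Computes

/-- The pairs listed by `pairsOf`. -/
def pairList : List α → List (α × α)
  | [] => []
  | x :: xs => xs.map (fun x' => (x, x')) ++ pairList xs

theorem length_pairList_le (l : List α) : (pairList l).length ≤ l.length ^ 2 := by
  induction l with
  | nil => simp [pairList]
  | cons x l ih => simp only [pairList, List.length_append, List.length_map, List.length_cons]; nlinarith

namespace Computes

theorem pairsWith (x : α) (acc : List (α × α)) (l : List α) :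
    Computes G y (Prog.pairsWith x acc l) (l.map (fun x' => (x, x')) ++ acc) (l.length + 1) := by
  induction l with
  | nil => exact compute _
  | cons x' l ih => exact (ih.bind_pure ((x, x') :: ·)).tick

theorem pairsOf (l : List α) :
    Computes G y (Prog.pairsOf l) (pairList l) ((l.length + 1) ^ 2) := by
  induction l with
  | nil => exact compute _
  | cons x l ih =>
    refine ((ih.bind (pairsWith x _ l)).tick).mono ?_
    rw [List.length_cons]; ring_nf; omega

theorem memNode (v : V) (l : List V) :
    Computes G y (Prog.memNode v l) (decide (v ∈ l)) (l.length * 2 + 1) := by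
  refine (existsIn fun x _ => askEqNode x v).congr ?_
  rw [Bool.eq_iff_iff]; simp

theorem memLabel (i : L) (l : List L) :
    Computes G y (Prog.memLabel (V := V) i l) (decide (i ∈ l)) (l.length * 2 + 1) := by
  refine (existsIn fun x _ => askEqLabel x i).congr ?_
  rw [Bool.eq_iff_iff]; simp

theorem removeLabel (i : L) (l : List L) :
    Computes G y (Prog.removeLabel (V := V) i l) (l.filter fun j => !decide (j = i))
      (l.length * 2 + 1) :=
  filterIn fun x _ => (askEqLabel x i).bind_pure (! ·)

/-- Ties are left unresolved in the statement: the analysis only uses that the winner is some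
maximizer. -/
theorem argmaxLoop {f : V → Prog V L ℕ} {g : V → ℕ} {c : ℕ} {l : List V}
    (h : ∀ x ∈ l, Computes G y (f x) (g x) c) (best : V) :
    ∃ a, (a = best ∨ a ∈ l) ∧ g best ≤ g a ∧ (∀ x ∈ l, g x ≤ g a) ∧
      Computes G y (Prog.argmaxLoop f best (g best) l) a (l.length * (c + 2) + 1) := by
  induction l generalizing best with
  | nil => exact ⟨best, .inl rfl, le_rfl, by simp, (compute best).mono (by simp)⟩
  | cons x l ih =>
    have hx := h x List.mem_cons_self
    have ih' := ih fun z hz => h z (List.mem_cons_of_mem _ hz)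
    by_cases hlt : g best < g x
    · obtain ⟨a, ha, hle, hmax, hc⟩ := ih' x
      refine ⟨a, .inr ?_, hlt.le.trans hle, ?_,
        ((hx.bind ((compute _).bind (c' := l.length * (c + 2) + 1) ?_)).tick).mono ?_⟩
      · rcases ha with rfl | ha
        · exact List.mem_cons_self
        · exact List.mem_cons_of_mem _ ha
      · simpa using ⟨hle, hmax⟩
      · simpa [hlt] using hc
      · rw [List.length_cons]; ring_nf; omega
    · obtain ⟨a, ha, hle, hmax, hc⟩ := ih' best
      refine ⟨a, ha.imp_right (List.mem_cons_of_mem _), hle, ?_,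
        ((hx.bind ((compute _).bind (c' := l.length * (c + 2) + 1) ?_)).tick).mono ?_⟩
      · simpa using ⟨(not_lt.1 hlt).trans hle, hmax⟩
      · simpa [hlt] using hc
      · rw [List.length_cons]; ring_nf; omega

theorem argmax {f : V → Prog V L ℕ} {g : V → ℕ} {c : ℕ} {l : List V}
    (h : ∀ x ∈ l, Computes G y (f x) (g x) c) (hl : l ≠ []) :
    ∃ a ∈ l, (∀ x ∈ l, g x ≤ g a) ∧
      Computes G y (Prog.argmax f l) (some a) (l.length * (c + 2) + 2) := by
  obtain _ | ⟨x, l⟩ := l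
  · exact absurd rfl hl
  obtain ⟨a, ha, hle, hmax, hc⟩ := argmaxLoop (fun z hz => h z (List.mem_cons_of_mem _ hz)) x
  refine ⟨a, List.mem_cons.2 ha, by simpa using ⟨hle, hmax⟩,
    (((h x List.mem_cons_self).bind (hc.bind (pure (some a) 0))).tick).mono ?_⟩
  rw [List.length_cons]; ring_nf; omega

theorem distinct4 (a b c d : V) :
    Computes G y (Prog.distinct4 a b c d) (decide [a, b, c, d].Nodup) 15 := by
  refine ((memNode a [b, c, d]).bind (c' := 8) ?_)
  by_cases ha : a ∈ [b, c, d]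
  · rw [decide_eq_true ha, if_pos rfl, decide_eq_false (by simp only [List.nodup_cons, ha]; simp)]
    exact pure _ _
  rw [decide_eq_false ha, if_neg (by simp)]
  refine ((memNode b [c, d]).bind (c' := 3) ?_)
  by_cases hb : b ∈ [c, d]
  · rw [decide_eq_true hb, if_pos rfl, decide_eq_false (by simp only [List.nodup_cons, hb]; simp)]
    exact pure _ _
  rw [decide_eq_false hb, if_neg (by simp)]
  refine ((memNode c [d]).bind (c' := 0) ?_)
  by_cases hc : c ∈ [d]
  · rw [decide_eq_true hc, if_pos rfl, decide_eq_false (by simp only [List.nodup_cons, hc]; simp)]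
    exact pure _ _
  rw [decide_eq_false hc, if_neg (by simp),
    decide_eq_true (by simp only [List.nodup_cons, ha, hb, hc]; simp)]
  exact pure _ _

theorem lookup {known : List (V × L)} (hk : ∀ p ∈ known, p.2 = y p.1) (v : V) :
    Computes G y (Prog.lookup v known)
      (if v ∈ known.map Prod.fst then some (y v) else none) (known.length * 2 + 1) := by
  induction known with
  | nil => exact compute _
  | cons p known ih =>
    obtain ⟨u, i⟩ := p
    obtain rfl : i = y u := hk (u, i) List.mem_cons_self
    have ih' := ih fun p hp => hk p (List.mem_cons_of_mem _ hp)
    refine (((askEqNode u v).bind (c' := known.length * 2 + 1) ?_).tick).mono ?_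
    · by_cases huv : u = v
      · subst huv
        simpa using pure (G := G) (y := y) (some (y u)) (known.length * 2 + 1)
      · have : ¬ v = u := fun h => huv h.symm
        rw [decide_eq_false huv, if_neg (by simp)]
        exact ih'.congr (by simp only [List.map_cons, List.mem_cons, this, false_or])
    · rw [List.length_cons]; omega

end Computes

end Exec

end Prog

/-! ### Distances and good quadruples -/

/-- The pairs `{a, b}` and `{c, d}` of four distinct nodes are joined by intersecting
shortest paths. -/
def IsGoodQuadruple {V : Type} (G : SimpleGraph V) (a b c d : V) : Prop :=
  [a, b, c, d].Nodup ∧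
    ∃ x, G.dist a x + G.dist x b = G.dist a b ∧ G.dist c x + G.dist x d = G.dist c d

open Classical in
/-- Boolean version of `IsGoodQuadruple`. -/
noncomputable def goodQuadruple {V : Type} (G : SimpleGraph V) (a b c d : V) : Bool :=
  decide (IsGoodQuadruple G a b c d)

theorem goodQuadruple_eq_true {V : Type} {G : SimpleGraph V} {a b c d : V} :
    goodQuadruple G a b c d = true ↔ IsGoodQuadruple G a b c d := by
  simp [goodQuadruple]

/-- Concatenating shortest paths through x gives a shortest path. The algorithm and the counting use
the metric form of intervals throughout; this direction suffices to apply convexity. -/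
theorem mem_geodesicInterval_of_dist {V : Type} {G : SimpleGraph V} (hG : G.Connected)
    {a b x : V} (h : G.dist a x + G.dist x b = G.dist a b) : x ∈ geodesicInterval G a b := by
  obtain ⟨p, hp⟩ := hG.exists_walk_length_eq_dist a x
  obtain ⟨q, hq⟩ := hG.exists_walk_length_eq_dist x b
  exact ⟨p.append q, by rw [SimpleGraph.Walk.length_append, hp, hq, h],
    SimpleGraph.Walk.mem_support_append_iff _ _ |>.2 (.inl p.end_mem_support)⟩

namespace SimpleGraph

variable {V : Type} {G : SimpleGraph V}

theorem Connected.dist_le_card [Fintype V] (hG : G.Connected) (u v : V) :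
    G.dist u v ≤ Fintype.card V := by
  obtain ⟨p, hp, hlen⟩ := (hG u v).exists_path_of_dist
  exact hlen ▸ hp.length_lt.le

/-- Correctness of one round of breadth-first search: the penultimate node of a shortest path is one
step closer. -/
theorem Connected.dist_le_succ_iff (hG : G.Connected) (u w : V) (i : ℕ) :
    G.dist u w ≤ i + 1 ↔ ∃ x, G.dist u x ≤ i ∧ (x = w ∨ G.Adj x w) := by
  constructor
  · intro h
    rcases h.lt_or_eq with h | h
    · exact ⟨w, Nat.lt_succ_iff.1 h, .inl rfl⟩
    obtain ⟨p, hp⟩ := hG.exists_walk_length_eq_dist u w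
    have hnil : ¬ p.Nil := fun hn => by
      have := SimpleGraph.Walk.length_eq_zero_iff.2 hn; omega
    refine ⟨p.penultimate, ?_, .inr (p.adj_penultimate hnil)⟩
    refine (SimpleGraph.dist_le p.dropLast).trans ?_
    have : p.dropLast.length = p.length - 1 := by simp
    omega
  · rintro ⟨x, hx, rfl | hadj⟩
    · omega
    · have := hG.dist_triangle (u := u) (v := x) (w := w)
      rw [SimpleGraph.dist_eq_one_iff_adj.2 hadj] at this
      omega

end SimpleGraph

/-! ### Breadth-first search, the goodness test and the lists of quadruples -/

namespace Prog

variable {V L : Type} [DecidableEq V] [DecidableEq L] {G : SimpleGraph V}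
  [DecidableRel G.Adj] {y : V → L}

namespace Computes

/-- Loop invariant: `B` is exactly the ball of radius `i`, and the target is in no smaller ball.
Hence `i` is the distance as soon as `v` shows up in `B`, or when the fuel, assumed long enough,
runs out. -/
theorem distLoop (hG : G.Connected) {nodes : List V} (hall : ∀ v, v ∈ nodes) (u v : V)
    (fuel : List V) (i : ℕ) (B : List V) (hB : ∀ w, w ∈ B ↔ G.dist u w ≤ i)
    (hlen : B.length ≤ nodes.length) (hi : i ≤ G.dist u v)
    (hfuel : G.dist u v ≤ i + fuel.length) :
    Computes G y (Prog.distLoop nodes v i B fuel) (G.dist u v)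
      (fuel.length * (nodes.length * (nodes.length * 3 + 4) + 3) + 1) := by
  induction fuel generalizing i B with
  | nil =>
    obtain rfl : i = G.dist u v := le_antisymm hi (by simpa using hfuel)
    exact (compute _).mono (by simp)
  | cons _ fuel ih =>
    refine (((memNode v B).bind (c' := nodes.length * (nodes.length * 3 + 2) + 1 +
      (fuel.length * (nodes.length * (nodes.length * 3 + 4) + 3) + 1)) ?_).tick).mono ?_
    · by_cases hv : v ∈ B
      · obtain rfl : i = G.dist u v := le_antisymm hi ((hB v).1 hv)
        rw [decide_eq_true hv, if_pos rfl]
        exact pure _ _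
      · rw [decide_eq_false hv, if_neg (by simp)]
        have hstep : ∀ w ∈ nodes, Computes G y (Prog.existsIn (fun x => do
            if ← Prog.askEqNode x w then Pure.pure true else Prog.askAdj x w) B)
            (B.any fun x => decide (x = w ∨ G.Adj x w)) (nodes.length * 3 + 1) := by
          intro w _
          refine (existsIn (c := 2) fun x _ => ?_).mono (by omega)
          refine (askEqNode x w).bind (c' := 1) ?_
          by_cases hxw : x = w
          · simpa [hxw] using pure (G := G) (y := y) true 1
          · simpa [hxw] using askAdj (G := G) (y := y) x w
        refine (filterIn hstep).bind (ih (i + 1) _ ?_ (List.length_filter_le _ _) ?_ ?_)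
        · intro w
          rw [List.mem_filter, hG.dist_le_succ_iff]
          simp [hall, hB]
        · have := mt (hB v).2 hv; omega
        · simp only [List.length_cons] at hfuel; omega
    · rw [List.length_cons]; ring_nf; omega

variable [Fintype V]

theorem dist (hG : G.Connected) {nodes : List V} (hall : ∀ v, v ∈ nodes) (u v : V) :
    Computes G y (Prog.dist nodes u v) (G.dist u v)
      (nodes.length * (nodes.length * (nodes.length * 3 + 4) + 3) + 1) := by
  have hcard : Fintype.card V ≤ nodes.length := by
    rw [← Finset.card_univ]
    refine (Finset.card_le_card fun w _ => List.mem_toFinset.2 (hall w)).trans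
      (List.toFinset_card_le nodes)
  refine distLoop hG hall u v nodes 0 [u] ?_ ?_ (Nat.zero_le _) ?_
  · intro w
    simp [hG.dist_eq_zero_iff, eq_comm]
  · exact List.length_pos_of_mem (hall u)
  · have := hG.dist_le_card u v; omega

variable {N : ℕ}

theorem onShortestPath (hG : G.Connected) {nodes : List V} (hall : ∀ v, v ∈ nodes)
    (hN : nodes.length + 16 ≤ N) (a b x : V) :
    Computes G y (Prog.onShortestPath nodes a b x)
      (decide (G.dist a x + G.dist x b = G.dist a b)) (N ^ 5) := by
  refine ((dist hG hall a x).bind ((dist hG hall x b).bind ((dist hG hall a b).bind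
    (f := fun m => Prog.compute (decide (G.dist a x + G.dist x b = m))) (compute _)))).mono ?_
  have h1 : nodes.length * 3 + 4 ≤ 4 * N := by omega
  have h2 : nodes.length * (nodes.length * 3 + 4) + 3 ≤ 4 * N ^ 2 :=
    calc _ ≤ nodes.length * (4 * N) + 3 := by gcongr
      _ ≤ (nodes.length + 1) * (4 * N) := by rw [add_mul]; omega
      _ ≤ N * (4 * N) := by gcongr; omega
      _ = _ := by ring
  have h3 : nodes.length * (nodes.length * (nodes.length * 3 + 4) + 3) + 1 ≤ 4 * N ^ 3 :=
    calc _ ≤ nodes.length * (4 * N ^ 2) + 1 := by gcongr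
      _ ≤ (nodes.length + 1) * (4 * N ^ 2) := by
        have : 1 ≤ N ^ 2 := Nat.one_le_pow _ _ (by omega)
        rw [add_mul]; omega
      _ ≤ N * (4 * N ^ 2) := by gcongr; omega
      _ = _ := by ring
  have h4 : 16 * N ^ 3 ≤ N ^ 5 :=
    calc 16 * N ^ 3 ≤ N * N * N ^ 3 := by gcongr; nlinarith
      _ = _ := by ring
  have : 1 ≤ N ^ 3 := Nat.one_le_pow _ _ (by omega)
  omega

theorem isGood (hG : G.Connected) {nodes : List V} (hall : ∀ v, v ∈ nodes)
    (hN : nodes.length + 16 ≤ N) (a b c d : V) :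
    Computes G y (Prog.isGood nodes a b c d) (goodQuadruple G a b c d) (N ^ 7) := by
  refine ((distinct4 a b c d).bind (c' := nodes.length * (2 * N ^ 5 + 1) + 1) ?_).mono ?_
  · by_cases hd : [a, b, c, d].Nodup
    · rw [decide_eq_true hd, if_pos rfl]
      refine (existsIn (c := 2 * N ^ 5) (g := fun x =>
        decide (G.dist a x + G.dist x b = G.dist a b ∧
          G.dist c x + G.dist x d = G.dist c d)) fun x _ => ?_).congr ?_
      · rw [two_mul]
        refine (onShortestPath hG hall hN a b x).bind ?_
        by_cases hx : G.dist a x + G.dist x b = G.dist a b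
        · rw [decide_eq_true hx, if_pos rfl]
          simpa [hx] using onShortestPath hG hall hN c d x
        · rw [decide_eq_false hx, if_neg (by simp)]
          simpa [hx] using pure (G := G) (y := y) false (N ^ 5)
      · rw [Bool.eq_iff_iff, goodQuadruple_eq_true]
        simp [IsGoodQuadruple, hd, hall]
    · rw [decide_eq_false hd, if_neg (by simp)]
      refine (pure false _).congr ?_
      rw [eq_comm, ← Bool.not_eq_true, goodQuadruple_eq_true]
      exact fun h => hd h.1
  · have h1 : 1 ≤ N ^ 5 := Nat.one_le_pow _ _ (by omega)
    calc 15 + (nodes.length * (2 * N ^ 5 + 1) + 1)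
        ≤ 16 * (3 * N ^ 5) + nodes.length * (3 * N ^ 5) := by
          have : nodes.length * (2 * N ^ 5 + 1) ≤ nodes.length * (3 * N ^ 5) := by
            gcongr; omega
          omega
      _ = (nodes.length + 16) * (3 * N ^ 5) := by ring
      _ ≤ N * (N * N ^ 5) := by gcongr; omega
      _ = _ := by ring

end Computes

/-- The list of quadruples produced by `quadruples`. -/
def quadrupleList (S : List V) : List ((V × V) × (V × V)) :=
  (pairList (pairList S)).filter fun q => decide [q.1.1, q.1.2, q.2.1, q.2.2].Nodup

theorem length_quadrupleList_le (S : List V) : (quadrupleList S).length ≤ S.length ^ 4 :=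
  calc _ ≤ _ := List.length_filter_le _ _
    _ ≤ _ := length_pairList_le _
    _ ≤ (S.length ^ 2) ^ 2 := Nat.pow_le_pow_left (length_pairList_le S) 2
    _ = _ := by ring

/-- All costs are bounded by pure powers of one `N` that exceeds every relevant list length by 16;
the next power of `N` then swallows up to sixteen lower terms, so that no constants need to be
tracked. -/
theorem sixteen_mul_pow_le {N i j : ℕ} (hN : 16 ≤ N) (hij : i < j) : 16 * N ^ i ≤ N ^ j :=
  calc 16 * N ^ i ≤ N * N ^ i := by gcongr
    _ = N ^ (i + 1) := by ring
    _ ≤ N ^ j := Nat.pow_le_pow_right (by omega) hij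

namespace Computes

variable {N : ℕ}

theorem quadruples {S : List V} (hN : S.length + 16 ≤ N) :
    Computes G y (Prog.quadruples S) (quadrupleList S) (N ^ 6) := by
  refine ((pairsOf S).bind ((pairsOf _).bind (filterIn (c := 15) fun q _ =>
    distinct4 _ _ _ _))).mono ?_
  have hP := length_pairList_le S
  have hPP := length_pairList_le (pairList S)
  have h1 : (S.length + 1) ^ 2 ≤ N ^ 2 := by gcongr; omega
  have h2 : (pairList S).length + 1 ≤ N ^ 2 := by nlinarith
  have h3 : ((pairList S).length + 1) ^ 2 ≤ N ^ 4 :=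
    calc _ ≤ (N ^ 2) ^ 2 := by gcongr
      _ = _ := by ring
  have h4 : (pairList (pairList S)).length + 1 ≤ N ^ 4 := by nlinarith
  have h5 := sixteen_mul_pow_le (N := N) (i := 4) (j := 5) (by omega) (by omega)
  have h6 := sixteen_mul_pow_le (N := N) (i := 5) (j := 6) (by omega) (by omega)
  have h7 := sixteen_mul_pow_le (N := N) (i := 2) (j := 4) (by omega) (by omega)
  omega

theorem goodQuadruples [Fintype V] (hG : G.Connected) {nodes : List V} (hall : ∀ v, v ∈ nodes)
    (hN : nodes.length + 16 ≤ N) {Q : List ((V × V) × (V × V))}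
    (hQ : Q.length ≤ nodes.length ^ 4) :
    Computes G y (Prog.goodQuadruples nodes Q)
      (Q.filter fun q => goodQuadruple G q.1.1 q.1.2 q.2.1 q.2.2) (N ^ 12) := by
  refine (filterIn fun q _ => isGood hG hall hN _ _ _ _).mono ?_
  have h1 : Q.length ≤ N ^ 4 := hQ.trans (by gcongr; omega)
  have h2 : 1 ≤ N ^ 7 := Nat.one_le_pow _ _ (by omega)
  have h3 := sixteen_mul_pow_le (N := N) (i := 11) (j := 12) (by omega) (by omega)
  have h4 : 1 ≤ N ^ 11 := Nat.one_le_pow _ _ (by omega)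
  calc Q.length * (N ^ 7 + 1) + 1 ≤ N ^ 4 * (2 * N ^ 7) + 1 := by gcongr; omega
    _ = 2 * N ^ 11 + 1 := by ring
    _ ≤ _ := by omega

end Computes

end Prog

/-! ### Counting good quadruples -/

section Counting

open Prog

theorem List.countP_eq_sum_map_ite {α : Type} (p : α → Bool) (l : List α) :
    l.countP p = (l.map fun x => if p x then 1 else 0).sum := by
  induction l with
  | nil => rfl
  | cons x l ih => rw [List.countP_cons, ih, List.map_cons, List.sum_cons, add_comm]

/-- A square of index pairs splits into its diagonal and two triangles; `pairList` enumerates one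
triangle. -/
theorem List.sum_map_sum_map_eq_pairList {α : Type} (f : α → α → ℕ) (l : List α) :
    (l.map fun x => (l.map fun x' => f x x').sum).sum =
      (l.map fun x => f x x).sum + ((pairList l).map fun p => f p.1 p.2 + f p.2 p.1).sum := by
  induction l with
  | nil => rfl
  | cons x l ih =>
    simp only [List.map_cons, List.sum_cons, pairList, List.map_append, List.sum_append,
      List.map_map, Function.comp_def, List.sum_map_add] at ih ⊢
    have : (l.map fun x' => f x x').sum = (l.map (f x)).sum := rfl
    omega

theorem List.sum_map_sum_map_of_symm {α : Type} {f : α → α → ℕ} (hs : ∀ x x', f x x' = f x' x)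
    (h0 : ∀ x, f x x = 0) (l : List α) :
    (l.map fun x => (l.map fun x' => f x x').sum).sum =
      2 * ((pairList l).map fun p => f p.1 p.2).sum := by
  rw [List.sum_map_sum_map_eq_pairList]
  simp only [h0, List.map_const', List.sum_replicate, smul_zero, zero_add, List.sum_map_add,
    fun p : α × α => hs p.2 p.1]
  omega

theorem List.nodup_four_reverse {α : Type} {a b c d : α} :
    [a, b, c, d].Nodup ↔ [d, c, b, a].Nodup := by
  rw [← List.nodup_reverse]; rfl

theorem List.nodup_four_swap_left {α : Type} {a b c d : α} :
    [a, b, c, d].Nodup ↔ [b, a, c, d].Nodup :=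
  (List.Perm.swap b a [c, d]).nodup_iff

theorem List.nodup_four_swap {α : Type} {a b c d : α} :
    [a, b, c, d].Nodup ↔ [c, d, a, b].Nodup :=
  (List.perm_append_comm (l₁ := [a, b]) (l₂ := [c, d])).nodup_iff

theorem List.nodup_four_swap_right {α : Type} {a b c d : α} :
    [a, b, c, d].Nodup ↔ [a, b, d, c].Nodup := by
  rw [List.nodup_four_swap, List.nodup_four_swap_left, List.nodup_four_swap]

theorem IsGoodQuadruple.swap {V : Type} {G : SimpleGraph V} {a b c d : V}
    (h : IsGoodQuadruple G a b c d) : IsGoodQuadruple G c d a b :=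
  ⟨List.nodup_four_swap.1 h.1, h.2.imp fun _ hx => hx.symm⟩

theorem IsGoodQuadruple.swap_left {V : Type} {G : SimpleGraph V} {a b c d : V}
    (h : IsGoodQuadruple G a b c d) : IsGoodQuadruple G b a c d :=
  ⟨List.nodup_four_swap_left.1 h.1, h.2.imp fun x hx =>
    ⟨by
      rw [G.dist_comm (u := b) (v := x), G.dist_comm (u := x) (v := a),
        G.dist_comm (u := b) (v := a), add_comm]
      exact hx.1, hx.2⟩⟩

theorem List.sum_toFinset_eq {α : Type} [DecidableEq α] {l : List α} (hl : l.Nodup) (f : α → ℕ) :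
    (l.map f).sum = ∑ x ∈ l.toFinset, f x :=
  (List.sum_toFinset f hl).symm

variable {V : Type} [DecidableEq V]

/-- A function on quadruples that only depends on the unordered pair of unordered pairs, and that
vanishes unless the four nodes are distinct. -/
structure IsQuadrupleFunction (f : V → V → V → V → ℕ) : Prop where
  swap_left : ∀ a b c d, f a b c d = f b a c d
  swap_right : ∀ a b c d, f a b c d = f a b d c
  swap : ∀ a b c d, f a b c d = f c d a b
  eq_zero : ∀ a b c d, ¬ [a, b, c, d].Nodup → f a b c d = 0

namespace IsQuadrupleFunction

variable {f : V → V → V → V → ℕ} (hf : IsQuadrupleFunction f)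
include hf

theorem sum_pairs {S : List V} (hS : S.Nodup) (a b : V) :
    ∑ c ∈ S.toFinset, ∑ d ∈ S.toFinset, f a b c d =
      2 * ((pairList S).map fun p => f a b p.1 p.2).sum := by
  rw [← List.sum_map_sum_map_of_symm (hf.swap_right a b), List.sum_toFinset_eq hS]
  · simp only [List.sum_toFinset_eq hS]
  · exact fun x => hf.eq_zero _ _ _ _ (by simp)

/-- The factor 8 is the number of orderings of an unordered pair of unordered pairs. It arises as
three factors 2: one for each inner pair and one for exchanging the two pairs. -/
theorem sum_quadruples {S : List V} (hS : S.Nodup) :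
    ∑ a ∈ S.toFinset, ∑ b ∈ S.toFinset, ∑ c ∈ S.toFinset, ∑ d ∈ S.toFinset, f a b c d =
      8 * ((quadrupleList S).map fun q => f q.1.1 q.1.2 q.2.1 q.2.2).sum := by
  have h1 : ((quadrupleList S).map fun q => f q.1.1 q.1.2 q.2.1 q.2.2).sum =
      ((pairList (pairList S)).map fun q => f q.1.1 q.1.2 q.2.1 q.2.2).sum := by
    unfold quadrupleList
    generalize pairList (pairList S) = PP
    induction PP with
    | nil => rfl
    | cons q PP ih =>
      by_cases hq : [q.1.1, q.1.2, q.2.1, q.2.2].Nodup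
      · rw [List.filter_cons_of_pos (by simpa using hq)]
        simp only [List.map_cons, List.sum_cons, ih]
      · rw [List.filter_cons_of_neg (by simpa using hq)]
        simp only [List.map_cons, List.sum_cons, ih, hf.eq_zero _ _ _ _ hq, zero_add]
  -- The diagonal drops out because a pair paired with itself does not have four distinct nodes.
  have h2 := List.sum_map_sum_map_of_symm (f := fun p p' : V × V => f p.1 p.2 p'.1 p'.2)
    (fun x x' => hf.swap _ _ _ _) (fun x => hf.eq_zero _ _ _ _ (by simp)) (pairList S)
  have h3 : ∑ a ∈ S.toFinset, ∑ b ∈ S.toFinset, ∑ c ∈ S.toFinset, ∑ d ∈ S.toFinset, f a b c d =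
      2 * ((pairList S).map fun p =>
        ∑ c ∈ S.toFinset, ∑ d ∈ S.toFinset, f p.1 p.2 c d).sum := by
    rw [← List.sum_map_sum_map_of_symm
      (f := fun a b => ∑ c ∈ S.toFinset, ∑ d ∈ S.toFinset, f a b c d)
      (fun a b => by simp only [hf.swap_left a b]), List.sum_toFinset_eq hS]
    · simp only [List.sum_toFinset_eq hS]
    · exact fun x => Finset.sum_eq_zero fun c _ => Finset.sum_eq_zero fun d _ =>
        hf.eq_zero _ _ _ _ (by simp)
  rw [h3, h1]
  simp only [hf.sum_pairs hS, List.sum_map_mul_left] at h2 ⊢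
  omega

end IsQuadrupleFunction

theorem sum_nodup_cons (F : Finset V) {l : List V} (hl : ∀ x ∈ l, x ∈ F) :
    (∑ d ∈ F, if (d :: l).Nodup then 1 else 0) = if l.Nodup then F.card - l.length else 0 := by
  split_ifs with h
  · rw [← Finset.card_filter, ← List.toFinset_card_of_nodup h,
      ← Finset.card_sdiff_of_subset fun x hx => hl x (List.mem_toFinset.1 hx)]
    congr 1
    ext x
    simp [h]
  · simp [List.nodup_cons, h]

/-- The tuple is written in reverse so that each inner summation variable is the head of the list,
as `sum_nodup_cons` requires. -/
theorem sum_nodup_four (F : Finset V) :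
    (∑ a ∈ F, ∑ b ∈ F, ∑ c ∈ F, ∑ d ∈ F, if [d, c, b, a].Nodup then 1 else 0) =
      F.card * (F.card - 1) * (F.card - 2) * (F.card - 3) := by
  have h4 : ∀ a ∈ F, ∀ b ∈ F, ∀ c ∈ F, (∑ d ∈ F, if [d, c, b, a].Nodup then 1 else 0) =
      (F.card - 3) * if [c, b, a].Nodup then 1 else 0 := fun a ha b hb c hc => by
    rw [sum_nodup_cons F (by simp [ha, hb, hc])]; simp
  have h3 : ∀ a ∈ F, ∀ b ∈ F, (∑ c ∈ F, if [c, b, a].Nodup then 1 else 0) =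
      (F.card - 2) * if [b, a].Nodup then 1 else 0 := fun a ha b hb => by
    rw [sum_nodup_cons F (by simp [ha, hb])]; simp
  have h2 : ∀ a ∈ F, (∑ b ∈ F, if [b, a].Nodup then 1 else 0) = F.card - 1 := fun a ha => by
    rw [sum_nodup_cons F (by simp [ha])]; simp
  calc _ = ∑ a ∈ F, ∑ b ∈ F, ∑ c ∈ F, (F.card - 3) * if [c, b, a].Nodup then 1 else 0 :=
        Finset.sum_congr rfl fun a ha => Finset.sum_congr rfl fun b hb =>
          Finset.sum_congr rfl fun c hc => h4 a ha b hb c hc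
    _ = ∑ a ∈ F, ∑ b ∈ F, (F.card - 3) * ((F.card - 2) * if [b, a].Nodup then 1 else 0) :=
        Finset.sum_congr rfl fun a ha => Finset.sum_congr rfl fun b hb => by
          rw [← Finset.mul_sum, h3 a ha b hb]
    _ = ∑ a ∈ F, (F.card - 3) * ((F.card - 2) * (F.card - 1)) :=
        Finset.sum_congr rfl fun a ha => by rw [← Finset.mul_sum, ← Finset.mul_sum, h2 a ha]
    _ = _ := by rw [Finset.sum_const, smul_eq_mul]; ring

theorem sum_nodup_two (F : Finset V) {a b : V} (ha : a ∈ F) (hb : b ∈ F) :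
    (∑ c ∈ F, ∑ d ∈ F, if [d, c, b, a].Nodup then 1 else 0) ≤ (F.card - 2) * (F.card - 3) :=
  calc _ = ∑ c ∈ F, (F.card - 3) * if [c, b, a].Nodup then 1 else 0 :=
        Finset.sum_congr rfl fun c hc => by
          rw [sum_nodup_cons F (by simp [ha, hb, hc])]; simp
    _ ≤ _ := by
        rw [← Finset.mul_sum, sum_nodup_cons F (by simp [ha, hb]), mul_comm]
        gcongr
        split_ifs <;> simp

theorem eight_mul_length_quadrupleList {S : List V} (hS : S.Nodup) :
    8 * (quadrupleList S).length =
      S.length * (S.length - 1) * (S.length - 2) * (S.length - 3) := by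
  have hf : IsQuadrupleFunction fun a b c d : V => if [a, b, c, d].Nodup then 1 else 0 :=
    { swap_left := fun a b c d => if_congr List.nodup_four_swap_left rfl rfl
      swap_right := fun a b c d => if_congr List.nodup_four_swap_right rfl rfl
      swap := fun a b c d => if_congr List.nodup_four_swap rfl rfl
      eq_zero := fun a b c d h => if_neg h }
  have h1 : (quadrupleList S).length = ((quadrupleList S).map fun q =>
      if [q.1.1, q.1.2, q.2.1, q.2.2].Nodup then 1 else 0).sum := by
    rw [List.map_congr_left (g := fun _ => 1) fun q hq => if_pos ?_]
    · simp
    · simpa using (List.mem_filter.1 hq).2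
  rw [h1, ← hf.sum_quadruples hS, ← List.toFinset_card_of_nodup hS, ← sum_nodup_four]
  simp only [List.nodup_four_reverse]

variable (G : SimpleGraph V)

/-- The indicator function of the good quadruples. -/
noncomputable def goodIndicator {V : Type} (G : SimpleGraph V) (a b c d : V) : ℕ := if goodQuadruple G a b c d then 1 else 0

theorem isQuadrupleFunction_goodIndicator {V : Type} (G : SimpleGraph V) :
    IsQuadrupleFunction (goodIndicator G) where
  swap_left a b c d := if_congr (by
    simp only [goodQuadruple_eq_true]; exact ⟨.swap_left, .swap_left⟩) rfl rfl
  swap_right a b c d := if_congr (by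
    simp only [goodQuadruple_eq_true]
    exact ⟨fun h => h.swap.swap_left.swap, fun h => h.swap.swap_left.swap⟩) rfl rfl
  swap a b c d := if_congr (by
    simp only [goodQuadruple_eq_true]; exact ⟨.swap, .swap⟩) rfl rfl
  eq_zero a b c d h := if_neg fun hg => h (goodQuadruple_eq_true.1 hg).1

theorem goodIndicator_le (a b c d : V) :
    goodIndicator G a b c d ≤ if [d, c, b, a].Nodup then 1 else 0 := by
  unfold goodIndicator
  by_cases h : goodQuadruple G a b c d = true
  · rw [if_pos h, if_pos (List.nodup_four_reverse.1 (goodQuadruple_eq_true.1 h).1)]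
  · rw [if_neg h]; exact Nat.zero_le _

theorem eight_mul_length_good {S : List V} (hS : S.Nodup) :
    8 * ((quadrupleList S).filter fun q => goodQuadruple G q.1.1 q.1.2 q.2.1 q.2.2).length =
      ∑ a ∈ S.toFinset, ∑ b ∈ S.toFinset, ∑ c ∈ S.toFinset, ∑ d ∈ S.toFinset,
        goodIndicator G a b c d := by
  rw [(isQuadrupleFunction_goodIndicator G).sum_quadruples hS, ← List.countP_eq_length_filter,
    List.countP_eq_sum_map_ite]
  rfl

theorem two_mul_countP_pairs {S : List V} (hS : S.Nodup) (a b : V) :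
    2 * (pairList S).countP (fun p => goodQuadruple G a b p.1 p.2) =
      ∑ c ∈ S.toFinset, ∑ d ∈ S.toFinset, goodIndicator G a b c d := by
  rw [(isQuadrupleFunction_goodIndicator G).sum_pairs hS, List.countP_eq_sum_map_ite]
  rfl

theorem countP_nodes {S : List V} (hS : S.Nodup) (a b c : V) :
    S.countP (fun d => goodQuadruple G a b c d) =
      ∑ d ∈ S.toFinset, goodIndicator G a b c d := by
  rw [List.countP_eq_sum_map_ite, List.sum_toFinset_eq hS]
  rfl

/-- Weight each good ordered quadruple by the number of its positions equal to x. By symmetry each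
of the four positions contributes the same sum, so the ordered total is four times the right-hand
side, while it is also eight times the number of good quadruples through x. -/
theorem two_mul_countP_good {S : List V} (hS : S.Nodup) {x : V} (hx : x ∈ S) :
    2 * ((quadrupleList S).filter fun q => goodQuadruple G q.1.1 q.1.2 q.2.1 q.2.2).countP
        (fun p => decide (x ∈ [p.1.1, p.1.2, p.2.1, p.2.2])) =
      ∑ b ∈ S.toFinset, ∑ c ∈ S.toFinset, ∑ d ∈ S.toFinset, goodIndicator G x b c d := by
  have hg := isQuadrupleFunction_goodIndicator G
  have hf : IsQuadrupleFunction fun a b c d : V => goodIndicator G a b c d *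
      ((if x = a then 1 else 0) + (if x = b then 1 else 0) +
        ((if x = c then 1 else 0) + (if x = d then 1 else 0))) :=
    { swap_left := fun a b c d => by
        rw [hg.swap_left a b, add_comm (if x = a then 1 else 0)]
      swap_right := fun a b c d => by
        rw [hg.swap_right a b, add_comm (if x = c then 1 else 0)]
      swap := fun a b c d => by
        rw [hg.swap a b, add_comm (_ + _)]
      eq_zero := fun a b c d h => by rw [hg.eq_zero _ _ _ _ h, zero_mul] }
  have h1 : ((quadrupleList S).filter fun q => goodQuadruple G q.1.1 q.1.2 q.2.1 q.2.2).countP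
        (fun p => decide (x ∈ [p.1.1, p.1.2, p.2.1, p.2.2])) =
      ((quadrupleList S).map fun q => goodIndicator G q.1.1 q.1.2 q.2.1 q.2.2 *
      ((if x = q.1.1 then 1 else 0) + (if x = q.1.2 then 1 else 0) +
        ((if x = q.2.1 then 1 else 0) + (if x = q.2.2 then 1 else 0)))).sum := by
    rw [List.countP_filter, List.countP_eq_sum_map_ite]
    congr 1
    refine List.map_congr_left fun q _ => ?_
    obtain ⟨⟨a, b⟩, c, d⟩ := q
    by_cases h : goodQuadruple G a b c d = true
    · have hn := (goodQuadruple_eq_true.1 h).1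
      simp only [List.nodup_cons, List.mem_cons, List.not_mem_nil, or_false, not_or] at hn
      obtain ⟨⟨h1, h2, h3⟩, ⟨h4, h5⟩, h6, -⟩ := hn
      simp only [goodIndicator, h, if_true, one_mul, Bool.and_true, decide_eq_true_eq,
        List.mem_cons, List.not_mem_nil, or_false]
      by_cases ha : x = a
      · subst ha; simp [h1, h2, h3]
      by_cases hb : x = b
      · subst hb; simp [ha, h4, h5]
      by_cases hc : x = c
      · subst hc; simp [ha, hb, h6]
      simp [ha, hb, hc]
    · simp [goodIndicator, h]
  have h2 := hf.sum_quadruples hS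
  rw [← h1] at h2
  have hxF : x ∈ S.toFinset := List.mem_toFinset.2 hx
  set F := S.toFinset
  have e1 : ∑ a ∈ F, ∑ b ∈ F, ∑ c ∈ F, ∑ d ∈ F,
      goodIndicator G a b c d * (if x = a then 1 else 0) =
      ∑ b ∈ F, ∑ c ∈ F, ∑ d ∈ F, goodIndicator G x b c d := by
    simp only [← Finset.sum_mul]
    simp [hxF]
  have e2 : ∑ a ∈ F, ∑ b ∈ F, ∑ c ∈ F, ∑ d ∈ F,
      goodIndicator G a b c d * (if x = b then 1 else 0) =
      ∑ b ∈ F, ∑ c ∈ F, ∑ d ∈ F, goodIndicator G x b c d := by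
    rw [← e1, Finset.sum_comm]
    simp only [fun a => hg.swap_left a]
  have e34 : ∀ g : V → V → V → V → ℕ, ∑ a ∈ F, ∑ b ∈ F, ∑ c ∈ F, ∑ d ∈ F, g a b c d =
      ∑ a ∈ F, ∑ b ∈ F, ∑ c ∈ F, ∑ d ∈ F, g c d a b := by
    intro g
    simp only [← Finset.sum_product']
    exact Finset.sum_bij' (fun p _ => (p.2.2.1, p.2.2.2, p.1, p.2.1))
      (fun p _ => (p.2.2.1, p.2.2.2, p.1, p.2.1)) (by simp +contextual) (by simp +contextual)
      (by simp) (by simp) (by simp)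
  have e3 : ∑ a ∈ F, ∑ b ∈ F, ∑ c ∈ F, ∑ d ∈ F,
      goodIndicator G a b c d * (if x = c then 1 else 0) =
      ∑ b ∈ F, ∑ c ∈ F, ∑ d ∈ F, goodIndicator G x b c d := by
    rw [e34, ← e1]
    simp only [fun a b c d => hg.swap c d a b]
  have e4 : ∑ a ∈ F, ∑ b ∈ F, ∑ c ∈ F, ∑ d ∈ F,
      goodIndicator G a b c d * (if x = d then 1 else 0) =
      ∑ b ∈ F, ∑ c ∈ F, ∑ d ∈ F, goodIndicator G x b c d := by
    rw [e34, ← e2]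
    simp only [fun a b c d => hg.swap c d a b]
  simp only [mul_add, Finset.sum_add_distrib, e1, e2, e3, e4] at h2
  omega

end Counting

/-! ### Clique minors and the existence of good quadruples -/

section Minor

variable {V : Type} {G : SimpleGraph V}

/-- One representative per branch set gives an injection. This bounds the set of clique minor sizes,
without which the supremum defining the Hadwiger number would be a junk value. -/
theorem card_ge_of_isGraphMinor_top [Fintype V] {w : ℕ}
    (h : IsGraphMinor (⊤ : SimpleGraph (Fin w)) G) : w ≤ Fintype.card V := by
  obtain ⟨B, hconn, hdisj, -⟩ := h
  have hne : ∀ i, ∃ v, v ∈ B i := fun i => by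
    obtain ⟨v⟩ := (hconn i).nonempty
    exact ⟨v.1, v.2⟩
  choose v hv using hne
  have hinj : Function.Injective v := fun i j hij => by
    by_contra hne
    exact Set.disjoint_left.1 (hdisj i j hne) (hv i) (hij ▸ hv j)
  simpa using Fintype.card_le_of_injective v hinj

theorem le_hadwigerNumber [Fintype V] {w : ℕ} (h : IsGraphMinor (⊤ : SimpleGraph (Fin w)) G) :
    w ≤ hadwigerNumber G :=
  le_csSup ⟨Fintype.card V, fun _ => card_ge_of_isGraphMinor_top⟩ h

theorem hadwigerNumber_le_card [Fintype V] : hadwigerNumber G ≤ Fintype.card V :=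
  csSup_le' fun _ => card_ge_of_isGraphMinor_top

theorem one_le_hadwigerNumber [Fintype V] (hG : G.Connected) : 1 ≤ hadwigerNumber G := by
  refine le_hadwigerNumber ⟨fun _ => Set.univ, fun _ => ?_, ?_, ?_⟩
  · exact (SimpleGraph.induceUnivIso G).connected_iff.2 hG
  · exact fun i j hij => absurd (Subsingleton.elim i j) hij
  · exact fun i j hij => absurd (Subsingleton.elim i j) hij.ne

/-! ### Geodesic intervals and the clique minor construction -/

theorem mem_interval_of_mem_interval (hG : G.Connected) {a b x z : V}
    (hx : G.dist a x + G.dist x b = G.dist a b) (hz : G.dist a z + G.dist z x = G.dist a x) :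
    G.dist a z + G.dist z b = G.dist a b := by
  have h1 := hG.dist_triangle (u := z) (v := x) (w := b)
  have h2 := hG.dist_triangle (u := a) (v := z) (w := b)
  omega

/-- On a geodesic from a to b, the point x comes after z. If z also lies on a geodesic from c to b,
the latter can be rerouted after z so that it passes through x. -/
theorem mem_interval_of_mem_interval_right (hG : G.Connected) {a b c x z : V}
    (hx : G.dist a x + G.dist x b = G.dist a b) (hz : G.dist a z + G.dist z x = G.dist a x)
    (hc : G.dist c z + G.dist z b = G.dist c b) : G.dist c x + G.dist x b = G.dist c b := by
  have h1 := hG.dist_triangle (u := z) (v := x) (w := b)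
  have h2 := hG.dist_triangle (u := a) (v := z) (w := b)
  have h3 := hG.dist_triangle (u := c) (v := z) (w := x)
  have h4 := hG.dist_triangle (u := c) (v := x) (w := b)
  omega

/-- If a set contains all shortest paths from `a` to `b`, then it contains a walk between them. -/
theorem reachable_induce_of_interval_subset (hG : G.Connected) {a b : V} {B : Set V}
    (hB : ∀ z, G.dist a z + G.dist z b = G.dist a b → z ∈ B) (ha : a ∈ B) (hb : b ∈ B) :
    (G.induce B).Reachable ⟨a, ha⟩ ⟨b, hb⟩ := by
  obtain ⟨p, hp⟩ := hG.exists_walk_length_eq_dist a b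
  have hsup : ∀ z ∈ p.support, z ∈ B := fun z hz => by
    refine hB z (le_antisymm ?_ hG.dist_triangle)
    obtain ⟨q, r, rfl⟩ := SimpleGraph.Walk.mem_support_iff_exists_append.1 hz
    rw [SimpleGraph.Walk.length_append] at hp
    have := SimpleGraph.dist_le q
    have := SimpleGraph.dist_le r
    omega
  exact ⟨p.induce B hsup⟩

/-- A walk that starts in `A`, ends in `B`, and stays in `A ∪ B` has an edge from `A` to `B`, or
the two sets meet. -/
theorem exists_adj_of_walk {A B : Set V} (hAB : Disjoint A B) {a b : V} (p : G.Walk a b)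
    (hp : ∀ z ∈ p.support, z ∈ A ∨ z ∈ B) (ha : a ∈ A) (hb : b ∈ B) :
    ∃ u ∈ A, ∃ v ∈ B, G.Adj u v := by
  induction p with
  | nil => exact absurd hb (Set.disjoint_left.1 hAB ha)
  | @cons a c b hadj p ih =>
    rcases hp c (by simp) with hc | hc
    · exact ih (fun z hz => hp z (by simp [hz])) hc hb
    · exact ⟨a, ha, c, hc, hadj⟩

/-- If shortest paths between disjoint pairs of `a i, b j` never meet, then there is
a large clique minor. -/
theorem isGraphMinor_of_disjoint_intervals (hG : G.Connected) {w : ℕ} (a b : Fin w → V)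
    (h : ∀ i j i' j' x, i ≠ i' → j ≠ j' → G.dist (a i) x + G.dist x (b j) = G.dist (a i) (b j) →
      ¬ G.dist (a i') x + G.dist x (b j') = G.dist (a i') (b j')) :
    IsGraphMinor (⊤ : SimpleGraph (Fin w)) G := by
  -- Think of (i, j) as row and column, and of `E x i j` as x occupying that cell. One path per pair
  -- of branch sets is enough, so only cells with i ≤ j are kept. Two cells occupied by the same
  -- point share a row or a column.
  set E : V → Fin w → Fin w → Prop := fun x i j =>
    i ≤ j ∧ G.dist (a i) x + G.dist x (b j) = G.dist (a i) (b j) with hE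
  have hmeet : ∀ {x i j i' j'}, E x i j → E x i' j' → i = i' ∨ j = j' := by
    intro x i j i' j' h1 h2
    by_contra! hne
    exact h i j i' j' x hne.1 hne.2 h1.2 h2.2
  -- The branch set of i is `R i ∪ C i`: points all of whose cells lie in row i, and points
  -- occupying at least two cells of column i. The latter occupy no cell outside that column, since
  -- such a cell could not share a row with both.
  set R : Fin w → Set V := fun i => {x | (∃ j, E x i j) ∧ ∀ l j, E x l j → l = i} with hR
  set C : Fin w → Set V := fun j => {x | ∃ l l', l ≠ l' ∧ E x l j ∧ E x l' j} with hC
  have hcover : ∀ {x i j}, E x i j → x ∈ R i ∨ x ∈ C j := by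
    intro x i j hx
    by_cases hall : ∀ l j', E x l j' → l = i
    · exact .inl ⟨⟨j, hx⟩, hall⟩
    · push Not at hall
      obtain ⟨l, j', hl, hli⟩ := hall
      obtain rfl : j' = j := (hmeet hl hx).resolve_left hli
      exact .inr ⟨l, i, hli, hl, hx⟩
  have hdiag : ∀ {x i}, E x i i → x ∈ R i ∪ C i := fun hx => hcover hx
  have hEa : ∀ {i j}, i ≤ j → E (a i) i j := fun hij => ⟨hij, by simp⟩
  have hEb : ∀ {i j}, i ≤ j → E (b j) i j := fun hij => ⟨hij, by simp⟩
  -- Walking from x back to a_i never leaves `R i`: if a point z on the way occupied a cell in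
  -- another row, that cell would be in the column of x, and rerouting through x would make x occupy
  -- that row too.
  have hRa : ∀ {x i}, x ∈ R i → ∀ z, G.dist (a i) z + G.dist z x = G.dist (a i) x → z ∈ R i := by
    rintro x i ⟨⟨j, hij, hx⟩, hrow⟩ z hz
    have hzE : E z i j := ⟨hij, mem_interval_of_mem_interval hG hx hz⟩
    refine ⟨⟨j, hzE⟩, fun l j' hl => ?_⟩
    by_contra hne
    obtain rfl : j' = j := (hmeet hl hzE).resolve_left hne
    exact hne (hrow l j' ⟨hl.1, mem_interval_of_mem_interval_right hG hx hz hl.2⟩)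
  -- Walking from x on to b_j keeps every cell of column j that x occupies.
  have hCb : ∀ {x j}, x ∈ C j → ∀ z, G.dist x z + G.dist z (b j) = G.dist x (b j) → z ∈ C j := by
    rintro x j ⟨l, l', hne, hl, hl'⟩ z hz
    have key : ∀ {l}, E x l j → E z l j := fun {l} hl => by
      refine ⟨hl.1, ?_⟩
      have h1 := hl.2
      have h2 := hG.dist_triangle (u := a l) (v := x) (w := z)
      have h3 := hG.dist_triangle (u := a l) (v := z) (w := b j)
      omega
    exact ⟨l, l', hne, key hl, key hl'⟩
  have hdisj : ∀ i j, i ≠ j → Disjoint (R i ∪ C i) (R j ∪ C j) := by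
    have hRC : ∀ {x i j}, x ∈ R i → x ∉ C j := by
      rintro x i j ⟨-, hrow⟩ ⟨l, l', hne, hl, hl'⟩
      exact hne ((hrow _ _ hl).trans (hrow _ _ hl').symm)
    intro i j hij
    rw [Set.disjoint_left]
    rintro x (hx | hx) (hx' | hx')
    · obtain ⟨m, hm⟩ := hx.1
      exact hij (hx'.2 i m hm)
    · exact hRC hx hx'
    · exact hRC hx' hx
    · obtain ⟨l, l', hne, hl, hl'⟩ := hx
      obtain ⟨m, -, -, hm, -⟩ := hx'
      exact hne (((hmeet hl hm).resolve_right hij).trans ((hmeet hl' hm).resolve_right hij).symm)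
  refine ⟨fun i => R i ∪ C i, fun i => ?_, hdisj, ?_⟩
  · have ha : a i ∈ R i ∪ C i := hdiag (hEa le_rfl)
    have hb : b i ∈ R i ∪ C i := hdiag (hEb le_rfl)
    have hab := reachable_induce_of_interval_subset hG (B := R i ∪ C i)
      (fun z hz => hdiag ⟨le_rfl, hz⟩) ha hb
    have hto : ∀ x : (R i ∪ C i : Set V), (G.induce (R i ∪ C i)).Reachable ⟨a i, ha⟩ x := by
      rintro ⟨x, hx⟩
      rcases id hx with hxR | hxC
      · exact reachable_induce_of_interval_subset hG
          (fun z hz => Or.inl (hRa hxR z hz)) ha hx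
      · exact hab.trans (reachable_induce_of_interval_subset hG
          (fun z hz => Or.inr (hCb hxC z hz)) hx hb).symm
    exact { preconnected := fun x x' => (hto x).symm.trans (hto x'), nonempty := ⟨⟨a i, ha⟩⟩ }
  · intro i j hij
    wlog hlt : i < j generalizing i j
    · obtain ⟨u, hu, v, hv, huv⟩ := this j i hij.symm (lt_of_le_of_ne (not_lt.1 hlt) hij.ne.symm)
      exact ⟨v, hv, u, hu, huv.symm⟩
    -- A geodesic from a_i to b_j occupies the cell (i, j) throughout, hence stays in `R i ∪ C j`
    -- and crosses from one branch set to the other.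
    obtain ⟨p, hp⟩ := hG.exists_walk_length_eq_dist (a i) (b j)
    refine exists_adj_of_walk (hdisj i j hij.ne) p (fun z hz => ?_) (hdiag (hEa le_rfl))
      (hdiag (hEb le_rfl))
    have hzE : E z i j := by
      refine ⟨hlt.le, le_antisymm ?_ hG.dist_triangle⟩
      obtain ⟨q, r, rfl⟩ := SimpleGraph.Walk.mem_support_iff_exists_append.1 hz
      rw [SimpleGraph.Walk.length_append] at hp
      have := SimpleGraph.dist_le q
      have := SimpleGraph.dist_le r
      omega
    exact (hcover hzE).imp Or.inl Or.inr

/-- Half of the 2h + 2 nodes serve as the a_i and half as the b_j; without good quadruples they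
would yield a clique minor on h + 1 nodes. -/
theorem exists_isGoodQuadruple [Fintype V] (hG : G.Connected) (F : Finset V)
    (hF : 2 * hadwigerNumber G + 2 ≤ F.card) :
    ∃ a ∈ F, ∃ b ∈ F, ∃ c ∈ F, ∃ d ∈ F, IsGoodQuadruple G a b c d := by
  by_contra! hno
  set w := hadwigerNumber G + 1 with hw
  obtain ⟨e⟩ : Nonempty (Fin w ⊕ Fin w ↪ F) :=
    Function.Embedding.nonempty_of_card_le (by simp; omega)
  have hinj : ∀ {s t}, s ≠ t → (e s : V) ≠ e t := fun hst heq =>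
    hst (e.injective (Subtype.ext heq))
  have := le_hadwigerNumber (isGraphMinor_of_disjoint_intervals hG (w := w)
    (fun i => e (.inl i)) (fun j => e (.inr j)) fun i j i' j' x hi hj hx hx' =>
      hno (e (.inl i)) (e _).2 (e (.inr j)) (e _).2 (e (.inl i')) (e _).2 (e (.inr j')) (e _).2
        ⟨?_, x, hx, hx'⟩)
  · omega
  · simp only [List.nodup_cons, List.mem_cons, List.not_mem_nil, or_false, not_or]
    exact ⟨⟨hinj (by simp), hinj (by simpa using hi), hinj (by simp)⟩,
      ⟨hinj (by simp), hinj (by simpa using hj)⟩, hinj (by simp), by simp, List.nodup_nil⟩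

/-- The number of ordered good quadruples. -/
noncomputable def orderedGoodCount (G : SimpleGraph V) (F : Finset V) : ℕ :=
  ∑ a ∈ F, ∑ b ∈ F, ∑ c ∈ F, ∑ d ∈ F, goodIndicator G a b c d

theorem one_le_orderedGoodCount {F : Finset V} {a b c d : V} (ha : a ∈ F) (hb : b ∈ F)
    (hc : c ∈ F) (hd : d ∈ F) (h : IsGoodQuadruple G a b c d) : 1 ≤ orderedGoodCount G F := by
  have h1 : goodIndicator G a b c d = 1 := if_pos (goodQuadruple_eq_true.2 h)
  rw [← h1]
  calc _ ≤ ∑ d ∈ F, goodIndicator G a b c d :=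
        Finset.single_le_sum (f := fun d => goodIndicator G a b c d) (fun _ _ => Nat.zero_le _) hd
    _ ≤ ∑ c ∈ F, ∑ d ∈ F, goodIndicator G a b c d :=
        Finset.single_le_sum (f := fun c => ∑ d ∈ F, goodIndicator G a b c d)
          (fun _ _ => Nat.zero_le _) hc
    _ ≤ ∑ b ∈ F, ∑ c ∈ F, ∑ d ∈ F, goodIndicator G a b c d :=
        Finset.single_le_sum (f := fun b => ∑ c ∈ F, ∑ d ∈ F, goodIndicator G a b c d)
          (fun _ _ => Nat.zero_le _) hb
    _ ≤ _ :=
        Finset.single_le_sum (f := fun a => ∑ b ∈ F, ∑ c ∈ F, ∑ d ∈ F, goodIndicator G a b c d)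
          (fun _ _ => Nat.zero_le _) ha

/-! ### From one good quadruple to a positive density -/

theorem orderedGoodCount_eq_card [DecidableEq V] (F : Finset V) :
    orderedGoodCount G F = ((F ×ˢ F ×ˢ F ×ˢ F).filter fun p =>
      goodQuadruple G p.1 p.2.1 p.2.2.1 p.2.2.2 = true).card := by
  rw [Finset.card_filter]
  simp only [Finset.sum_product]
  rfl

/-- Double counting: a good quadruple survives the deletion of v exactly when v is not one of its
four nodes. -/
theorem sum_orderedGoodCount_erase [DecidableEq V] (F : Finset V) :
    ∑ v ∈ F, orderedGoodCount G (F.erase v) = orderedGoodCount G F * (F.card - 4) := by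
  have h1 : ∀ v ∈ F, orderedGoodCount G (F.erase v) =
      ((((F ×ˢ F ×ˢ F ×ˢ F).filter fun p =>
      goodQuadruple G p.1 p.2.1 p.2.2.1 p.2.2.2 = true)).filter fun p =>
        v ∉ [p.1, p.2.1, p.2.2.1, p.2.2.2]).card := fun v _ => by
    rw [orderedGoodCount_eq_card]
    congr 1
    ext ⟨a, b, c, d⟩
    simp only [Finset.mem_filter, Finset.mem_product, Finset.mem_erase, List.mem_cons,
      List.not_mem_nil, or_false, not_or, ne_eq, eq_comm (a := v)]
    tauto
  rw [Finset.sum_congr rfl h1, orderedGoodCount_eq_card]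
  simp only [Finset.card_filter _ (Finset.filter _ _)]
  rw [Finset.sum_comm, Finset.sum_congr rfl (g := fun _ => F.card - 4), Finset.sum_const,
    smul_eq_mul]
  rintro ⟨a, b, c, d⟩ hp
  simp only [Finset.mem_filter, Finset.mem_product] at hp
  have hn := (goodQuadruple_eq_true.1 hp.2).1
  have := sum_nodup_cons F (l := [a, b, c, d]) (by simp [hp.1])
  simpa only [List.nodup_cons (l := [a, b, c, d]), hn, and_true, if_true, List.length_cons,
    List.length_nil] using this

/-- The density of good quadruples in F is the average of their densities in the sets F \ {v}, so a
lower bound valid for all sets of size t propagates upwards by induction. -/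
theorem descFactorial_le_orderedGoodCount [DecidableEq V] {t : ℕ} (ht : 4 ≤ t)
    (hgood : ∀ F : Finset V, F.card = t → 1 ≤ orderedGoodCount G F) (F : Finset V)
    (hF : t ≤ F.card) :
    F.card * (F.card - 1) * (F.card - 2) * (F.card - 3) ≤
      orderedGoodCount G F * (t * (t - 1) * (t - 2) * (t - 3)) := by
  generalize hn : F.card = n at hF ⊢
  induction n, hF using Nat.le_induction generalizing F with
  | base => exact Nat.le_mul_of_pos_left _ (hgood F hn)
  | succ n hnt ih =>
    have h1 : ∀ v ∈ F, n * (n - 1) * (n - 2) * (n - 3) ≤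
        orderedGoodCount G (F.erase v) * (t * (t - 1) * (t - 2) * (t - 3)) := fun v hv => by
      refine ih _ ?_
      rw [Finset.card_erase_of_mem hv, hn, Nat.add_sub_cancel]
    have h2 := Finset.sum_le_sum h1
    rw [Finset.sum_const, ← Finset.sum_mul, sum_orderedGoodCount_erase, hn, smul_eq_mul] at h2
    have h3 : n + 1 - 4 = n - 3 := by omega
    rw [h3] at h2
    refine Nat.le_of_mul_le_mul_right (c := n - 3) ?_ (by omega)
    calc _ = (n + 1) * (n * (n - 1) * (n - 2) * (n - 3)) := by
          rw [show n + 1 - 1 = n by omega, show n + 1 - 2 = n - 1 by omega,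
            show n + 1 - 3 = n - 2 by omega]; ring
      _ ≤ _ := h2
      _ = _ := by ring

/-- Sets with at least 2h + 2 ≤ 4h nodes are covered by averaging from size 2h + 2. For smaller sets
the single good quadruple granted by the hypothesis is already dense enough. -/
theorem le_orderedGoodCount_mul [Fintype V] [DecidableEq V] (hG : G.Connected) (F : Finset V)
    (hF : 1 ≤ orderedGoodCount G F) :
    F.card * (F.card - 1) * (F.card - 2) * (F.card - 3) ≤
      orderedGoodCount G F * (4 * hadwigerNumber G) ^ 4 := by
  have hh := one_le_hadwigerNumber hG
  have hpow : ∀ s, s ≤ 4 * hadwigerNumber G →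
      s * (s - 1) * (s - 2) * (s - 3) ≤ (4 * hadwigerNumber G) ^ 4 := fun s hs =>
    calc _ ≤ s * s * s * s := by gcongr <;> omega
      _ = s ^ 4 := by ring
      _ ≤ _ := by gcongr
  rcases le_total (2 * hadwigerNumber G + 2) F.card with h | h
  · refine (descFactorial_le_orderedGoodCount (t := 2 * hadwigerNumber G + 2) (by omega) ?_ F
      h).trans (Nat.mul_le_mul_left _ (hpow _ (by omega)))
    intro F hF
    obtain ⟨a, ha, b, hb, c, hc, d, hd, hgood⟩ := exists_isGoodQuadruple hG F hF.ge
    exact one_le_orderedGoodCount ha hb hc hd hgood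
  · exact (hpow _ (by omega)).trans (Nat.le_mul_of_pos_left _ hF)

end Minor

/-! ### Sizes of the candidate sets -/

section Thresholds

open Prog

variable {V : Type} [DecidableEq V] (G : SimpleGraph V) (S : List V)

/-- The good quadruples in `S`, as listed by the algorithm. -/
noncomputable def goodList : List ((V × V) × (V × V)) :=
  (quadrupleList S).filter fun q => goodQuadruple G q.1.1 q.1.2 q.2.1 q.2.2

/-- The threshold parameter `ε` of the algorithm. -/
noncomputable def goodDensity : ℚ :=
  ((goodList G S).length : ℚ) / (8 * (quadrupleList S).length)

/-- The candidates for the partner of `a`. -/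
noncomputable def firstCandidates (a : V) : List V :=
  S.filter fun b' => decide (⌈2 * goodDensity G S * ((S.length : ℚ) - 2) * ((S.length : ℚ) - 3)⌉ ≤
    ((pairList S).countP (fun p => goodQuadruple G a b' p.1 p.2) : ℤ))

/-- The candidates for the third node after `a` and `b`. -/
noncomputable def secondCandidates (a b : V) : List V :=
  S.filter fun c' => decide (⌈goodDensity G S * ((S.length : ℚ) - 3)⌉ ≤
    (S.countP (fun d => goodQuadruple G a b c' d) : ℤ))

/-- The candidates for the fourth node after `a`, `b` and `c`. -/
noncomputable def thirdCandidates (a b c : V) : List V :=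
  S.filter fun d' => goodQuadruple G a b c d'

variable {G S}

theorem length_filter_eq_card (hS : S.Nodup) (p : V → Bool) :
    (S.filter p).length = (S.toFinset.filter fun x => p x = true).card := by
  rw [← List.toFinset_card_of_nodup (hS.filter p), List.toFinset_filter]

theorem four_le_length (hS : S.Nodup) (hgood : goodList G S ≠ []) : 4 ≤ S.length := by
  have h1 := eight_mul_length_quadrupleList hS
  have h2 : 0 < (quadrupleList S).length :=
    (List.length_pos_of_ne_nil hgood).trans_le (List.length_filter_le _ _)
  by_contra! h
  rw [show S.length - 3 = 0 by omega] at h1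
  omega

theorem cast_descFactorial {s : ℕ} (hs : 4 ≤ s) :
    ((s * (s - 1) * (s - 2) * (s - 3) : ℕ) : ℚ) = s * (s - 1) * (s - 2) * (s - 3) := by
  push_cast [Nat.cast_sub (show 1 ≤ s by omega), Nat.cast_sub (show 2 ≤ s by omega),
    Nat.cast_sub (show 3 ≤ s by omega)]
  ring

theorem eight_mul_goodDensity_mul (hS : S.Nodup) (hgood : goodList G S ≠ []) :
    8 * goodDensity G S *
      ((S.length : ℚ) * (S.length - 1) * (S.length - 2) * (S.length - 3)) =
        orderedGoodCount G S.toFinset := by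
  have h1 : (8 : ℚ) * (goodList G S).length = orderedGoodCount G S.toFinset := by
    exact_mod_cast eight_mul_length_good G hS
  have h2 : (0 : ℚ) < (quadrupleList S).length := by
    exact_mod_cast (List.length_pos_of_ne_nil hgood).trans_le (List.length_filter_le _ _)
  rw [← cast_descFactorial (four_le_length hS hgood), ← eight_mul_length_quadrupleList hS, ← h1,
    goodDensity]
  push_cast
  field_simp

theorem goodDensity_pos (hgood : goodList G S ≠ []) : 0 < goodDensity G S := by
  have h1 := List.length_pos_of_ne_nil hgood
  have h2 : 0 < (quadrupleList S).length := h1.trans_le (List.length_filter_le _ _)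
  unfold goodDensity
  positivity

/-- The constant is 2048 = 8·4^4: the 8 comes from the definition of ε, and (4h)^4 from the density
bound. -/
theorem le_goodDensity [Fintype V] (hG : G.Connected) (hS : S.Nodup)
    (hgood : goodList G S ≠ []) : 1 / (2048 * (hadwigerNumber G : ℚ) ^ 4) ≤ goodDensity G S := by
  have h1 := eight_mul_goodDensity_mul hS hgood
  have h4 := four_le_length hS hgood
  have hpos := List.length_pos_of_ne_nil hgood
  have h2 := le_orderedGoodCount_mul hG S.toFinset (by
    have := eight_mul_length_good G hS
    unfold orderedGoodCount
    unfold goodList at hpos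
    omega)
  rw [List.toFinset_card_of_nodup hS] at h2
  have h3 : ((S.length * (S.length - 1) * (S.length - 2) * (S.length - 3) : ℕ) : ℚ) ≤
      ((orderedGoodCount G S.toFinset * (4 * hadwigerNumber G) ^ 4 : ℕ) : ℚ) := by
    exact_mod_cast h2
  have h5 : (0 : ℚ) < ((S.length * (S.length - 1) * (S.length - 2) * (S.length - 3) : ℕ) : ℚ) := by
    have : 0 < S.length * (S.length - 1) * (S.length - 2) * (S.length - 3) :=
      Nat.mul_pos (Nat.mul_pos (Nat.mul_pos (by omega) (by omega)) (by omega)) (by omega)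
    exact_mod_cast this
  rw [← cast_descFactorial h4] at h1
  rw [Nat.cast_mul (orderedGoodCount _ _), ← h1] at h3
  set s4 := ((S.length * (S.length - 1) * (S.length - 2) * (S.length - 3) : ℕ) : ℚ)
  have hh : (1 : ℚ) ≤ hadwigerNumber G := by exact_mod_cast one_le_hadwigerNumber hG
  rw [div_le_iff₀ (by positivity)]
  push_cast at h3
  refine le_of_mul_le_mul_right ?_ h5
  rw [one_mul]
  exact h3.trans_eq (by ring)

theorem length_le_of_goodList_eq_nil [Fintype V] (hG : G.Connected) (hS : S.Nodup)
    (hgood : goodList G S = []) : S.length ≤ 2 * hadwigerNumber G + 1 := by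
  by_contra! h
  obtain ⟨a, ha, b, hb, c, hc, d, hd, hq⟩ := exists_isGoodQuadruple hG S.toFinset (by
    rw [List.toFinset_card_of_nodup hS]; omega)
  have h1 := one_le_orderedGoodCount ha hb hc hd hq
  have h2 := eight_mul_length_good G hS
  unfold goodList at hgood
  rw [hgood] at h2
  unfold orderedGoodCount at h1
  simp only [List.length_nil] at h2
  omega

/-- If a sum over `F` of terms at most `m` is large, then many terms reach the threshold `t`. -/
theorem sum_le_card_filter_mul_add {V : Type} {F : Finset V} {f : V → ℚ} {m t : ℚ} (ht : 0 ≤ t)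
    (hm : ∀ x ∈ F, f x ≤ m) :
    ∑ x ∈ F, f x ≤ (F.filter fun x => t ≤ f x).card * m + F.card * t := by
  rw [← Finset.sum_filter_add_sum_filter_not F (fun x => t ≤ f x)]
  refine add_le_add ?_ ?_
  · rw [← nsmul_eq_mul]
    exact Finset.sum_le_card_nsmul _ _ _ fun x hx => hm x (Finset.mem_filter.1 hx).1
  · refine (Finset.sum_le_card_nsmul _ _ t fun x hx =>
      (not_le.1 (Finset.mem_filter.1 hx).2).le).trans ?_
    rw [nsmul_eq_mul]
    gcongr
    exact Finset.filter_subset _ _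

/-- Since a has maximal degree, the ordered good quadruples starting with a number at least
8ε(s-1)(s-2)(s-3). Each b accounts for at most (s-2)(s-3) of them, and each b below the threshold
for less than 4ε(s-2)(s-3), twice the threshold because the pairs (c, d) are ordered here. -/
theorem le_length_firstCandidates (hS : S.Nodup) (hgood : goodList G S ≠ []) {a : V} (ha : a ∈ S)
    (hmax : ∀ x ∈ S, (goodList G S).countP (fun p => decide (x ∈ [p.1.1, p.1.2, p.2.1, p.2.2])) ≤
      (goodList G S).countP (fun p => decide (a ∈ [p.1.1, p.1.2, p.2.1, p.2.2]))) :
    goodDensity G S / 4 * S.length ≤ (firstCandidates G S a).length := by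
  have hε := goodDensity_pos hgood
  have h8 := eight_mul_goodDensity_mul hS hgood
  have hs4 : (4 : ℚ) ≤ S.length := by exact_mod_cast four_le_length hS hgood
  set F := S.toFinset with hF
  have hcard : F.card = S.length := List.toFinset_card_of_nodup hS
  set ε := goodDensity G S with hεdef
  set s := (S.length : ℚ) with hs
  set deg : V → ℕ := fun x => ∑ b ∈ F, ∑ c ∈ F, ∑ d ∈ F, goodIndicator G x b c d with hdeg
  have hdega : ∀ x ∈ F, deg x ≤ deg a := fun x hx => by
    have h1 := two_mul_countP_good G hS (List.mem_toFinset.1 hx)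
    have h2 := two_mul_countP_good G hS ha
    have h3 := hmax x (List.mem_toFinset.1 hx)
    unfold goodList at h3
    rw [← hF] at h1 h2
    simp only [hdeg]
    omega
  have h1 : (orderedGoodCount G F : ℚ) ≤ s * deg a := by
    have : orderedGoodCount G F ≤ F.card • deg a := Finset.sum_le_card_nsmul _ _ _ hdega
    rw [hcard, smul_eq_mul] at this
    rw [hs]
    exact_mod_cast this
  have h2 : 8 * ε * ((s - 1) * (s - 2) * (s - 3)) ≤ deg a := by
    refine le_of_mul_le_mul_left ?_ (show 0 < s by linarith)
    calc _ = 8 * ε * (s * (s - 1) * (s - 2) * (s - 3)) := by ring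
      _ ≤ _ := h8 ▸ h1
  set N : V → ℚ := fun b =>
    2 * ((pairList S).countP (fun p => goodQuadruple G a b p.1 p.2) : ℕ) with hN
  have h3 : (deg a : ℚ) = ∑ b ∈ F, N b := by
    simp only [hdeg, hN, Nat.cast_sum (s := F)]
    refine Finset.sum_congr rfl fun b _ => ?_
    exact_mod_cast (two_mul_countP_pairs G hS a b).symm
  have h4 : ∀ b ∈ F, N b ≤ (s - 2) * (s - 3) := fun b hb => by
    have h5 : 2 * (pairList S).countP (fun p => goodQuadruple G a b p.1 p.2) ≤
        (S.length - 2) * (S.length - 3) := by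
      rw [two_mul_countP_pairs G hS a b, ← hcard]
      exact (Finset.sum_le_sum fun c _ => Finset.sum_le_sum fun d _ =>
        goodIndicator_le G a b c d).trans (sum_nodup_two F (List.mem_toFinset.2 ha) hb)
    have h6 : ((2 * (pairList S).countP (fun p => goodQuadruple G a b p.1 p.2) : ℕ) : ℚ) ≤
        (((S.length - 2) * (S.length - 3) : ℕ) : ℚ) := by exact_mod_cast h5
    have h7 := four_le_length hS hgood
    push_cast [Nat.cast_sub (show 2 ≤ S.length by omega),
      Nat.cast_sub (show 3 ≤ S.length by omega)] at h6
    exact h6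
  have hpos : 0 < (s - 2) * (s - 3) := mul_pos (by linarith) (by linarith)
  have h5 := sum_le_card_filter_mul_add (t := 4 * ε * ((s - 2) * (s - 3))) (by positivity) h4
  have h6 : (firstCandidates G S a).length =
      (F.filter fun b => 4 * ε * ((s - 2) * (s - 3)) ≤ N b).card := by
    rw [firstCandidates, length_filter_eq_card hS]
    congr 1
    refine Finset.filter_congr fun b _ => ?_
    rw [decide_eq_true_eq, Int.ceil_le, hN, Int.cast_natCast]
    constructor <;> intro h <;> linarith
  rw [← h3, ← h6, hcard] at h5
  have h7 : (8 * ε * (s - 1)) * ((s - 2) * (s - 3)) ≤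
      ((firstCandidates G S a).length + s * (4 * ε)) * ((s - 2) * (s - 3)) := by linarith
  -- This leaves 8ε(s-1) - 4εs candidates, which is at least 2εs because s ≥ 4.
  have h8 := le_of_mul_le_mul_right h7 hpos
  nlinarith

/-- Same counting one level down: b brings 4ε(s-2)(s-3) ordered pairs (c, d), each c accounts for at
most s - 3, and those below the threshold for less than ε(s-3) each. At least 4ε(s-2) - εs ≥ εs
candidates remain. -/
theorem le_length_secondCandidates (hS : S.Nodup) (hgood : goodList G S ≠ []) {a b : V}
    (ha : a ∈ S) (hb : b ∈ firstCandidates G S a) :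
    goodDensity G S / 4 * S.length ≤ (secondCandidates G S a b).length := by
  have hε := goodDensity_pos hgood
  have hs4 : (4 : ℚ) ≤ S.length := by exact_mod_cast four_le_length hS hgood
  obtain ⟨hbS, hbN⟩ := List.mem_filter.1 hb
  rw [decide_eq_true_eq, Int.ceil_le, Int.cast_natCast] at hbN
  set F := S.toFinset with hF
  have hcard : F.card = S.length := List.toFinset_card_of_nodup hS
  set ε := goodDensity G S with hεdef
  set M : V → ℚ := fun c => ((S.countP (fun d => goodQuadruple G a b c d) : ℕ) : ℚ) with hM
  have h1 : (2 : ℚ) * ((pairList S).countP (fun p => goodQuadruple G a b p.1 p.2) : ℕ) =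
      ∑ c ∈ F, M c := by
    simp only [hM, countP_nodes G hS]
    exact_mod_cast two_mul_countP_pairs G hS a b
  have h2 : ∀ c ∈ F, M c ≤ (S.length : ℚ) - 3 := fun c hc => by
    have h3 : S.countP (fun d => goodQuadruple G a b c d) ≤ S.length - 3 := by
      rw [countP_nodes G hS, ← hcard]
      refine (Finset.sum_le_sum fun d _ => goodIndicator_le G a b c d).trans ?_
      rw [sum_nodup_cons F (by
        simpa [hF] using ⟨List.mem_toFinset.1 hc, hbS, ha⟩)]
      split_ifs <;> simp
    have h4 : ((S.countP (fun d => goodQuadruple G a b c d) : ℕ) : ℚ) ≤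
        ((S.length - 3 : ℕ) : ℚ) := by exact_mod_cast h3
    rwa [Nat.cast_sub (by have := four_le_length hS hgood; omega)] at h4
  have hpos : 0 < (S.length : ℚ) - 3 := by linarith
  have h5 := sum_le_card_filter_mul_add (t := ε * ((S.length : ℚ) - 3)) (by positivity) h2
  have h6 : (secondCandidates G S a b).length =
      (F.filter fun c => ε * ((S.length : ℚ) - 3) ≤ M c).card := by
    rw [secondCandidates, length_filter_eq_card hS]
    congr 1
    refine Finset.filter_congr fun c _ => ?_
    rw [decide_eq_true_eq, Int.ceil_le, hM, Int.cast_natCast]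
  rw [← h1, ← h6, hcard] at h5
  have h7 : (4 * ε * (S.length - 2)) * ((S.length : ℚ) - 3) ≤
      ((secondCandidates G S a b).length + S.length * ε) * ((S.length : ℚ) - 3) := by linarith
  have h8 := le_of_mul_le_mul_right h7 hpos
  nlinarith

/-- The threshold defining Y_ab is itself the bound: ε(s-3) ≥ εs/4 for s ≥ 4. This is the tightest
of the three estimates and the source of the factor 1/4. -/
theorem le_length_thirdCandidates (hS : S.Nodup) (hgood : goodList G S ≠ []) {a b c : V}
    (hc : c ∈ secondCandidates G S a b) :
    goodDensity G S / 4 * S.length ≤ (thirdCandidates G S a b c).length := by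
  have hε := goodDensity_pos hgood
  have hs4 : (4 : ℚ) ≤ S.length := by exact_mod_cast four_le_length hS hgood
  obtain ⟨-, hcN⟩ := List.mem_filter.1 hc
  rw [decide_eq_true_eq, Int.ceil_le, Int.cast_natCast, List.countP_eq_length_filter] at hcN
  refine le_trans ?_ hcN
  nlinarith

end Thresholds

/-! ### Learners -/

/-- The list `known` consists of true labels of different nodes. -/
structure IsValidKnowledge {V L : Type} (y : V → L) (known : List (V × L)) : Prop where
  nodup : (known.map Prod.fst).Nodup
  eq_label : ∀ p ∈ known, p.2 = y p.1

theorem IsValidKnowledge.length_le {V L : Type} [Fintype V] {y : V → L} {known : List (V × L)}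
    (h : IsValidKnowledge y known) : known.length ≤ Fintype.card V := by
  simpa using h.nodup.length_le_card

theorem mem_keys_of_suffix {V L : Type} {known known' : List (V × L)} (h : known <:+ known')
    {v : V} (hv : v ∈ known.map Prod.fst) : v ∈ known'.map Prod.fst :=
  (h.map _).subset hv

namespace Learner

open Prog

variable {V L α β : Type} [DecidableEq V] [DecidableEq L] (G : SimpleGraph V)
  [DecidableRel G.Adj] (y : V → L)

/-- Started with the labels in `known`, the learner `P` takes at most `c` steps, makes at most `μ`
mistakes, correctly records its trials, and its result satisfies `post`. -/
structure Spec (P : Learner V L α) (known : List (V × L)) (c : ℕ) (μ : ℝ)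
    (post : α → List (V × L) → Prop) : Prop where
  steps_le : ((P known).exec G y).steps ≤ c
  mistakes_le : (((P known).exec G y).mistakes y : ℝ) ≤ μ
  known_eq : ((P known).exec G y).result.2 =
    (((P known).exec G y).trials.map fun t => (t.1, y t.1)).reverse ++ known
  nodup : (((P known).exec G y).result.2.map Prod.fst).Nodup
  post : post ((P known).exec G y).result.1 ((P known).exec G y).result.2

variable {G y} {known : List (V × L)}

/-! ### Composition rules for specifications of learners -/

namespace Spec

theorem isValid {P : Learner V L α} {c : ℕ} {μ : ℝ} {post : α → List (V × L) → Prop}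
    (h : Spec G y P known c μ post) (hk : IsValidKnowledge y known) :
    IsValidKnowledge y ((P known).exec G y).result.2 := by
  refine ⟨h.nodup, fun p hp => ?_⟩
  rw [h.known_eq, List.mem_append] at hp
  rcases hp with hp | hp
  · simp only [List.mem_reverse, List.mem_map] at hp
    obtain ⟨t, -, rfl⟩ := hp
    rfl
  · exact hk.eq_label p hp

theorem mono {P : Learner V L α} {c c' : ℕ} {μ μ' : ℝ} {post post' : α → List (V × L) → Prop}
    (h : Spec G y P known c μ post) (hc : c ≤ c') (hμ : μ ≤ μ')
    (hpost : ∀ a known', post a known' → post' a known') : Spec G y P known c' μ' post' :=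
  ⟨h.steps_le.trans hc, h.mistakes_le.trans hμ, h.known_eq, h.nodup, hpost _ _ h.post⟩

/-- Costs and mistakes add up. The suffix relation handed to the continuation records that labels
once known stay known. -/
theorem bind {P : Learner V L α} {f : α → Learner V L β} {c c' : ℕ} {μ μ' : ℝ}
    {post : α → List (V × L) → Prop} {post' : β → List (V × L) → Prop}
    (hk : IsValidKnowledge y known) (h : Spec G y P known c μ post)
    (h' : ∀ a known', IsValidKnowledge y known' → known <:+ known' → post a known' →
      Spec G y (f a) known' c' μ' post') :
    Spec G y (P >>= f) known (c + c') (μ + μ') post' := by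
  have e := Prog.exec_seq G y (P known) fun r => f r.1 r.2
  change ((P >>= f) known).exec G y = _ at e
  have h2 := h' _ _ (h.isValid hk) (h.known_eq ▸ List.suffix_append _ _) h.post
  constructor
  · rw [e]; exact Nat.add_le_add h.steps_le h2.steps_le
  · rw [e]
    have := add_le_add h.mistakes_le h2.mistakes_le
    simp only [Execution.mistakes, List.countP_append, Nat.cast_add] at this ⊢
    exact this
  · rw [e]
    simp only [List.map_append, List.reverse_append, List.append_assoc]
    rw [← h.known_eq]
    exact h2.known_eq
  · rw [e]; exact h2.nodup
  · rw [e]; exact h2.post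

theorem pure {post : α → List (V × L) → Prop} (hk : IsValidKnowledge y known) (a : α)
    (h : post a known) (c : ℕ) {μ : ℝ} (hμ : 0 ≤ μ) :
    Spec G y (Pure.pure a : Learner V L α) known c μ post :=
  ⟨Nat.zero_le _, by change ((0 : ℕ) : ℝ) ≤ μ; simpa using hμ, rfl, hk.nodup, h⟩

theorem call {p : Prog V L α} {a : α} {c : ℕ} {post : α → List (V × L) → Prop}
    (hk : IsValidKnowledge y known) (hp : Computes G y p a c) (h : post a known) :
    Spec G y (Learner.call p) known c 0 post := by
  have hb : (Learner.call p known).exec G y = ⟨(a, known), (p.exec G y).steps + 0, [] ++ []⟩ := by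
    have e := Prog.exec_seq G y p fun a => .done (a, known)
    change (Learner.call p known).exec G y = _ at e
    rw [hp.result, hp.trials] at e
    exact e
  constructor
  · rw [hb]; exact hp.steps_le
  · rw [hb]; simp [Execution.mistakes]
  · rw [hb]; rfl
  · rw [hb]; exact hk.nodup
  · rw [hb]; exact h

theorem call_bind {p : Prog V L α} {f : α → Learner V L β} {a : α} {c c' : ℕ} {μ : ℝ}
    {post : β → List (V × L) → Prop} (hk : IsValidKnowledge y known) (hp : Computes G y p a c)
    (h : Spec G y (f a) known c' μ post) :
    Spec G y (Learner.call p >>= f) known (c + c') μ post := by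
  have := bind hk (call (post := fun r s => r = a ∧ s = known) hk hp ⟨rfl, rfl⟩)
    (f := f) (c' := c') (μ' := μ) (post' := post) (by
      rintro a known' - - ⟨rfl, rfl⟩
      exact h)
  rwa [zero_add] at this

theorem get_bind {f : List (V × L) → Learner V L β} {c : ℕ} {μ : ℝ}
    {post : β → List (V × L) → Prop} (h : Spec G y (f known) known c μ post) :
    Spec G y (get >>= f) known c μ post :=
  ⟨h.steps_le, h.mistakes_le, h.known_eq, h.nodup, h.post⟩

end Spec

variable [Fintype V] {N : ℕ}

theorem learn_spec (hN : Fintype.card V + 16 ≤ N) (hk : IsValidKnowledge y known) (v : V)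
    (guess : L) :
    Spec G y (learn v guess) known (N ^ 2) (if y v = guess then 0 else 1) fun i known' =>
      i = y v ∧ v ∈ known'.map Prod.fst := by
  have hlen := hk.length_le
  have hc : known.length * 2 + 1 + 1 ≤ N ^ 2 := by nlinarith
  refine Spec.mono (Spec.get_bind (Spec.call_bind hk (Computes.lookup hk.eq_label v) (c' := 1)
    (μ := if y v = guess then 0 else 1) (post := fun i known' =>
      i = y v ∧ v ∈ known'.map Prod.fst) ?_)) hc le_rfl fun _ _ h => h
  by_cases hv : v ∈ known.map Prod.fst
  · rw [if_pos hv]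
    exact Spec.pure hk _ ⟨rfl, hv⟩ _ (by split_ifs <;> norm_num)
  · rw [if_neg hv]
    refine ⟨le_rfl, ?_, rfl, ?_, rfl, ?_⟩
    · by_cases h : y v = guess
      · rw [if_pos h]
        have : (([(v, guess)] : List (V × L)).countP fun t => decide (t.2 ≠ y t.1)) = 0 := by
          simp [h]
        exact_mod_cast this.le
      · rw [if_neg h]
        have : (([(v, guess)] : List (V × L)).countP fun t => decide (t.2 ≠ y t.1)) ≤ 1 :=
          List.countP_le_length
        exact_mod_cast this
    · exact List.nodup_cons.2 ⟨hv, hk.nodup⟩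
    · exact List.mem_cons_self

/-- One mistake suffices for any length of `S`: the scan stops at the first label different from the
prediction. -/
theorem findOther_spec (hN : Fintype.card V + 16 ≤ N) (z : L) (S : List V)
    (hk : IsValidKnowledge y known) :
    Spec G y (findOther z S) known (S.length * (N ^ 2 + 1) + 1) 1 fun r known' =>
      match r with
      | some (v, l) => v ∈ S ∧ y v = l ∧ l ≠ z
      | none => ∀ v ∈ S, v ∈ known'.map Prod.fst := by
  induction S generalizing known with
  | nil =>
    exact (Spec.call hk (Computes.compute none) (by simp)).mono (by simp) zero_le_one
      fun _ _ h => h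
  | cons a S ih =>
    have hc : N ^ 2 + (1 + (S.length * (N ^ 2 + 1) + 1)) =
        (a :: S).length * (N ^ 2 + 1) + 1 := by rw [List.length_cons]; ring
    rw [← hc]
    by_cases hya : y a = z
    · refine (Spec.bind hk (learn_spec hN hk a z) (μ' := 1) fun i known' hk' _ hi => ?_).mono
        le_rfl (by simp [hya]) fun _ _ h => h
      obtain ⟨rfl, hi⟩ := hi
      refine Spec.call_bind hk' (Computes.askEqLabel _ _) ?_
      rw [decide_eq_true hya, if_pos rfl]
      have h1 := ih hk'
      refine ⟨h1.steps_le, h1.mistakes_le, h1.known_eq, h1.nodup, ?_⟩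
      have h2 := h1.post
      have h3 : known' <:+ ((findOther z S known').exec G y).result.2 := by
        rw [h1.known_eq]; exact List.suffix_append _ _
      revert h2 h3
      generalize ((findOther z S known').exec G y).result = r
      obtain ⟨_ | ⟨v, l⟩, s⟩ := r
      · intro h2 h3 v hv
        rcases List.mem_cons.1 hv with rfl | hv
        · exact mem_keys_of_suffix h3 hi
        · exact h2 v hv
      · exact fun h2 _ => ⟨List.mem_cons_of_mem _ h2.1, h2.2⟩
    · refine (Spec.bind hk (learn_spec hN hk a z) (μ' := 0) fun i known' hk' _ hi => ?_).mono
        le_rfl (by simp [hya]) fun _ _ h => h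
      obtain ⟨rfl, hi⟩ := hi
      refine Spec.call_bind hk' (Computes.askEqLabel _ _) ?_
      rw [decide_eq_false hya, if_neg (by simp)]
      exact Spec.pure hk' _ ⟨List.mem_cons_self, rfl, hya⟩ _ le_rfl

theorem predictAll_spec (hN : Fintype.card V + 16 ≤ N) (z : L) (U : List V)
    (hk : IsValidKnowledge y known) :
    Spec G y (predictAll z U) known (U.length * N ^ 2 + 1) U.length fun _ known' =>
      ∀ v, v ∈ U ∨ v ∈ known.map Prod.fst → v ∈ known'.map Prod.fst := by
  induction U generalizing known with
  | nil =>
    exact (Spec.call hk (Computes.compute ()) (by simp)).mono (by simp) (by simp)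
      fun _ _ h => h
  | cons a U ih =>
    refine (Spec.bind hk (learn_spec hN hk a z) (c' := U.length * N ^ 2 + 1) (μ' := U.length)
      fun i known' hk' hsuf hi => (ih hk').mono le_rfl le_rfl fun _ known'' h v hv => ?_).mono
      (by rw [List.length_cons]; ring_nf; omega) ?_ fun _ _ h => h
    · refine h v ?_
      rcases hv with hv | hv
      · rcases List.mem_cons.1 hv with rfl | hv
        · exact .inr hi.2
        · exact .inl hv
      · exact .inr (mem_keys_of_suffix hsuf hv)
    · rw [List.length_cons]; push_cast; split_ifs <;> linarith

end Learner

/-! ### Analysis of `FindDistinctLabel` -/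

/-- A common point of the two intervals would lie in both clusters. This is where convexity of the
labeling enters. -/
theorem IsConvexLabeling.not_isGoodQuadruple {V L : Type} {G : SimpleGraph V} {y : V → L}
    (hy : IsConvexLabeling G y) (hG : G.Connected) {a b c d : V} (hab : y b = y a)
    (hcd : y d = y c) (hac : y c ≠ y a) : ¬ IsGoodQuadruple G a b c d := by
  rintro ⟨-, x, hx, hx'⟩
  have h1 : y x = y a := hy (y a) a rfl b hab (mem_geodesicInterval_of_dist hG hx)
  have h2 : y x = y c := hy (y c) c rfl d hcd (mem_geodesicInterval_of_dist hG hx')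
  exact hac (h2.symm.trans h1)

/-- At least `r` nodes of `S` have a known label. -/
def HasKnownPart {V L : Type} [DecidableEq V] (r : ℚ) (S : List V) (known : List (V × L)) : Prop :=
  ∃ T ⊆ S.toFinset, (∀ v ∈ T, v ∈ known.map Prod.fst) ∧ r ≤ T.card

/-- The factor by which each level of the recursion may shrink the set of nodes. -/
noncomputable def shrinkFactor {V : Type} (G : SimpleGraph V) : ℚ :=
  1 / (8192 * (hadwigerNumber G : ℚ) ^ 4)

theorem shrinkFactor_pos {V : Type} [Fintype V] {G : SimpleGraph V} (hG : G.Connected) :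
    0 < shrinkFactor G := by
  have : (0 : ℚ) < hadwigerNumber G := by exact_mod_cast one_le_hadwigerNumber hG
  unfold shrinkFactor
  positivity

/-- In a set too small to guarantee a good quadruple, a single known node is already a fraction δ.
-/
theorem shrinkFactor_mul_le {V : Type} [Fintype V] {G : SimpleGraph V} (hG : G.Connected) {s : ℕ}
    (hs : s ≤ 2 * hadwigerNumber G + 1) : shrinkFactor G * s ≤ 1 := by
  have h1 : (1 : ℚ) ≤ hadwigerNumber G := by exact_mod_cast one_le_hadwigerNumber hG
  have h2 : (s : ℚ) ≤ 2 * hadwigerNumber G + 1 := by exact_mod_cast hs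
  have h3 : (hadwigerNumber G : ℚ) ≤ (hadwigerNumber G : ℚ) ^ 4 := le_self_pow₀ h1 (by norm_num)
  rw [shrinkFactor, one_div_mul_eq_div, div_le_one (by positivity)]
  linarith

theorem shrinkFactor_le_one {V : Type} [Fintype V] {G : SimpleGraph V} (hG : G.Connected) :
    shrinkFactor G ≤ 1 := by
  simpa using shrinkFactor_mul_le hG (s := 1) (by omega)

namespace HasKnownPart

variable {V L : Type} [DecidableEq V] {G : SimpleGraph V} {S Y : List V}
  {known : List (V × L)}

theorem of_forall (hS : S.Nodup) (h : ∀ v ∈ S, v ∈ known.map Prod.fst) :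
    HasKnownPart S.length S known :=
  ⟨S.toFinset, le_rfl, by simpa using h, by rw [List.toFinset_card_of_nodup hS]⟩

theorem mono {r r' : ℚ} (h : HasKnownPart r S known) (hr : r' ≤ r) : HasKnownPart r' S known :=
  let ⟨T, hT, hk, hc⟩ := h
  ⟨T, hT, hk, hr.trans hc⟩

/-- Passing from a candidate set back to S loses at most a factor δ, because the candidates make up
a fraction ε/4 ≥ δ of S. If S has no good quadruples, the candidate sets may be tiny, but then |S| ≤
2h + 1 and the learned node a alone suffices. -/
theorem of_candidates [Fintype V] (hG : G.Connected) (hS : S.Nodup) {a : V} (ha : a ∈ S)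
    (hak : a ∈ known.map Prod.fst) (hYS : Y ⊆ S)
    (hbig : goodList G S ≠ [] → goodDensity G S / 4 * S.length ≤ Y.length) {m : ℕ}
    (h : HasKnownPart (shrinkFactor G ^ m * Y.length) Y known) :
    HasKnownPart (shrinkFactor G ^ (m + 1) * S.length) S known := by
  have hδ := shrinkFactor_pos hG
  by_cases hgood : goodList G S = []
  · refine ⟨{a}, by simpa using ha, by simpa using hak, ?_⟩
    have h1 := shrinkFactor_mul_le hG (length_le_of_goodList_eq_nil hG hS hgood)
    have h2 : shrinkFactor G ^ m ≤ 1 := pow_le_one₀ hδ.le (shrinkFactor_le_one hG)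
    rw [pow_succ, mul_assoc, Finset.card_singleton, Nat.cast_one]
    exact mul_le_one₀ h2 (by positivity) h1
  · obtain ⟨T, hTY, hTk, hT⟩ := h
    refine ⟨T, fun v hv => ?_, hTk, le_trans ?_ hT⟩
    · have := hTY hv
      simp only [List.mem_toFinset] at this ⊢
      exact hYS this
    · rw [pow_succ, mul_assoc]
      refine mul_le_mul_of_nonneg_left (le_trans ?_ (hbig hgood)) (by positivity)
      refine mul_le_mul_of_nonneg_right ?_ (by positivity)
      have := le_goodDensity hG hS hgood
      -- 8192 = 4·2048 combines the lower bound on ε with the factor 1/4 lost in choosing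
      -- candidates.
      have h4 : shrinkFactor G = 1 / (2048 * (hadwigerNumber G : ℚ) ^ 4) / 4 := by
        rw [shrinkFactor, div_div]; ring
      rw [h4]
      linarith

end HasKnownPart

namespace Learner

open Prog

variable {V L : Type} [DecidableEq V] [DecidableEq L] [Fintype V] {G : SimpleGraph V}
  [DecidableRel G.Adj] {y : V → L}

/-- What `FindDistinctLabel` achieves on the nodes `S` and labels `Z`, for `|Z| = m + 1`. -/
def IsOutcome (G : SimpleGraph V) (y : V → L) (m : ℕ) (S : List V) (Z : List L)
    (r : Option (V × L)) (known : List (V × L)) : Prop :=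
  match r with
  | some (v, l) => v ∈ S ∧ y v = l ∧ l ∉ Z
  | none => HasKnownPart (shrinkFactor G ^ m * S.length) S known

variable {nodes : List V} {N : ℕ}

/-! ### Candidate lists and the recursive specification -/

theorem length_le_of_nodup {V : Type} [Fintype V] {S : List V} (hN : Fintype.card V + 16 ≤ N) (hS : S.Nodup) :
    S.length + 16 ≤ N :=
  (Nat.add_le_add_right hS.length_le_card 16).trans hN

theorem computes_firstCandidates (hG : G.Connected) (hall : ∀ v, v ∈ nodes)
    (hN : nodes.length + 16 ≤ N) {S : List V} (hS : S.length + 16 ≤ N) (a : V) :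
    Computes G y (filterIn (fun b' => do
        let M ← countIn (fun p => isGood nodes a b' p.1 p.2) (pairList S)
        compute (decide (⌈2 * goodDensity G S * ((S.length : ℚ) - 2) * ((S.length : ℚ) - 3)⌉ ≤
          (M : ℤ)))) S)
      (firstCandidates G S a) (N ^ 11) := by
  refine (Computes.filterIn fun b' _ => (Computes.countIn fun p _ =>
    Computes.isGood hG hall hN a b' p.1 p.2).bind (Computes.compute _)).mono ?_
  have h1 : (pairList S).length ≤ N ^ 2 :=
    (length_pairList_le S).trans (Nat.pow_le_pow_left (by omega) 2)
  have h2 : 1 ≤ N ^ 7 := Nat.one_le_pow _ _ (by omega)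
  have h3 : 1 ≤ N ^ 9 := Nat.one_le_pow _ _ (by omega)
  have h4 := sixteen_mul_pow_le (N := N) (i := 10) (j := 11) (by omega) (by omega)
  have h5 : 1 ≤ N ^ 10 := Nat.one_le_pow _ _ (by omega)
  have h6 : (pairList S).length * (N ^ 7 + 2) ≤ 3 * N ^ 9 :=
    calc _ ≤ N ^ 2 * (3 * N ^ 7) := by gcongr; omega
      _ = _ := by ring
  calc _ ≤ N * (7 * N ^ 9) + 1 := by gcongr <;> omega
    _ = 7 * N ^ 10 + 1 := by ring
    _ ≤ _ := by omega

theorem computes_secondCandidates (hG : G.Connected) (hall : ∀ v, v ∈ nodes)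
    (hN : nodes.length + 16 ≤ N) {S : List V} (hS : S.length + 16 ≤ N) (a b : V) :
    Computes G y (filterIn (fun c' => do
        let M ← countIn (fun d => isGood nodes a b c' d) S
        compute (decide (⌈goodDensity G S * ((S.length : ℚ) - 3)⌉ ≤ (M : ℤ)))) S)
      (secondCandidates G S a b) (N ^ 11) := by
  refine (Computes.filterIn fun c' _ => (Computes.countIn fun d _ =>
    Computes.isGood hG hall hN a b c' d).bind (Computes.compute _)).mono ?_
  have h2 : 1 ≤ N ^ 7 := Nat.one_le_pow _ _ (by omega)
  have h3 : 1 ≤ N ^ 8 := Nat.one_le_pow _ _ (by omega)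
  have h4 := sixteen_mul_pow_le (N := N) (i := 9) (j := 11) (by omega) (by omega)
  have h5 : 1 ≤ N ^ 9 := Nat.one_le_pow _ _ (by omega)
  have h6 : S.length * (N ^ 7 + 2) ≤ 3 * N ^ 8 :=
    calc _ ≤ N * (3 * N ^ 7) := by gcongr <;> omega
      _ = _ := by ring
  calc _ ≤ N * (7 * N ^ 8) + 1 := by gcongr <;> omega
    _ = 7 * N ^ 9 + 1 := by ring
    _ ≤ _ := by omega

theorem computes_thirdCandidates (hG : G.Connected) (hall : ∀ v, v ∈ nodes)
    (hN : nodes.length + 16 ≤ N) {S : List V} (hS : S.length + 16 ≤ N) (a b c : V) :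
    Computes G y (filterIn (fun d' => isGood nodes a b c d') S) (thirdCandidates G S a b c)
      (N ^ 11) := by
  refine (Computes.filterIn fun d' _ => Computes.isGood hG hall hN a b c d').mono ?_
  have h2 : 1 ≤ N ^ 7 := Nat.one_le_pow _ _ (by omega)
  have h4 := sixteen_mul_pow_le (N := N) (i := 8) (j := 11) (by omega) (by omega)
  have h5 : 1 ≤ N ^ 8 := Nat.one_le_pow _ _ (by omega)
  calc _ ≤ N * (2 * N ^ 7) + 1 := by gcongr <;> omega
    _ = 2 * N ^ 8 + 1 := by ring
    _ ≤ _ := by omega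

theorem computes_argmax {V L : Type} [DecidableEq V] [DecidableEq L] {G : SimpleGraph V}
    [DecidableRel G.Adj] {y : V → L} {S : List V} (hS : S.length + 16 ≤ N) :
    ∃ o : Option V, Computes G y (argmax (fun a' =>
        countIn (fun p : (V × V) × (V × V) => memNode a' [p.1.1, p.1.2, p.2.1, p.2.2])
          (goodList G S)) S) o (N ^ 11) ∧
      (o = none ∧ S = [] ∨ ∃ a ∈ S, o = some a ∧ ∀ x ∈ S,
        (goodList G S).countP (fun p => decide (x ∈ [p.1.1, p.1.2, p.2.1, p.2.2])) ≤
        (goodList G S).countP (fun p => decide (a ∈ [p.1.1, p.1.2, p.2.1, p.2.2]))) := by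
  have h5 : 1 ≤ N ^ 5 := Nat.one_le_pow _ _ (by omega)
  by_cases hS0 : S = []
  · subst hS0
    exact ⟨none, (Computes.compute none).mono (Nat.one_le_pow _ _ (by omega)), .inl ⟨rfl, rfl⟩⟩
  · obtain ⟨a, ha, hmax, hc⟩ := Computes.argmax (G := G) (y := y) (l := S)
      (f := fun a' => countIn (fun p : (V × V) × (V × V) =>
        memNode a' [p.1.1, p.1.2, p.2.1, p.2.2]) (goodList G S))
      (g := fun a' => (goodList G S).countP fun p =>
        decide (a' ∈ [p.1.1, p.1.2, p.2.1, p.2.2])) (c := (goodList G S).length * 11 + 2)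
      (fun a' _ => Computes.countIn fun p _ =>
        Computes.memNode a' [p.1.1, p.1.2, p.2.1, p.2.2]) hS0
    refine ⟨some a, hc.mono ?_, .inr ⟨a, ha, rfl, hmax⟩⟩
    have h1 : (goodList G S).length ≤ N ^ 4 :=
      (List.length_filter_le _ _).trans ((length_quadrupleList_le S).trans
        (Nat.pow_le_pow_left (by omega) 4))
    have h2 : 1 ≤ N ^ 4 := Nat.one_le_pow _ _ (by omega)
    have h4 := sixteen_mul_pow_le (N := N) (i := 5) (j := 6) (by omega) (by omega)
    have h6 := sixteen_mul_pow_le (N := N) (i := 6) (j := 11) (by omega) (by omega)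
    calc _ ≤ N * (15 * N ^ 4) + 2 := by gcongr <;> omega
      _ = 15 * N ^ 5 + 2 := by ring
      _ ≤ _ := by omega

theorem length_filter_ne {Z : List L} (hZ : Z.Nodup) {m : ℕ} (hm : Z.length = m + 2) {i : L}
    (hi : i ∈ Z) : (Z.filter fun j => !decide (j = i)).length = m + 1 := by
  have h1 := hZ.erase_eq_filter i
  have h2 := List.length_erase_of_mem hi
  rw [h1, hm] at h2
  simpa [bne, beq_eq_decide] using h2

/-- The left side lists the costs of the instructions of one call in program order along its longest
branch, with `R` for each of the two recursive calls. -/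
theorem findDistinctLabel_cost {s l q g R : ℕ} (hs : s + 16 ≤ N) (hl : l + 16 ≤ N)
    (hq : q ≤ N ^ 4) (hg : g ≤ N ^ 4) :
    N ^ 6 + (N ^ 12 + ((q + 1) + ((g + 1) + ((s + 1) + (1 + (N ^ 11 +
      (N ^ 2 + ((l * 2 + 1) + ((s + 1) ^ 2 + (N ^ 11 + ((l * 2 + 1) + (R + (1 +
        (N ^ 11 + ((s * (N ^ 2 + 1) + 1) + ((l * 2 + 1) +
          (N ^ 11 + ((l * 2 + 1) + (R + (1 + 0)))))))))))))))))))) ≤ 2 * R + N ^ 13 := by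
  have h2 : 1 ≤ N ^ 2 := Nat.one_le_pow _ _ (by omega)
  have h4 : s * (N ^ 2 + 1) ≤ 2 * N ^ 3 :=
    calc _ ≤ N * (2 * N ^ 2) := by gcongr <;> omega
      _ = _ := by ring
  have h5 : (s + 1) ^ 2 ≤ N ^ 2 := Nat.pow_le_pow_left (by omega) 2
  have p1 := sixteen_mul_pow_le (N := N) (i := 12) (j := 13) (by omega) (by omega)
  have p2 := sixteen_mul_pow_le (N := N) (i := 11) (j := 12) (by omega) (by omega)
  have p3 := sixteen_mul_pow_le (N := N) (i := 6) (j := 11) (by omega) (by omega)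
  have p4 := sixteen_mul_pow_le (N := N) (i := 4) (j := 6) (by omega) (by omega)
  have p5 := sixteen_mul_pow_le (N := N) (i := 3) (j := 4) (by omega) (by omega)
  have p6 := sixteen_mul_pow_le (N := N) (i := 2) (j := 3) (by omega) (by omega)
  have p7 := sixteen_mul_pow_le (N := N) (i := 1) (j := 2) (by omega) (by omega)
  rw [pow_one] at p7
  generalize N ^ 13 = x13 at *
  generalize N ^ 12 = x12 at *
  generalize N ^ 11 = x11 at *
  generalize N ^ 6 = x6 at *
  generalize N ^ 4 = x4 at *
  generalize N ^ 3 = x3 at *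
  generalize s * (N ^ 2 + 1) = t at *
  generalize (s + 1) ^ 2 = u at *
  generalize N ^ 2 = x2 at *
  linarith

set_option maxHeartbeats 800000 in
-- Induction on the number of labels. The step bound solves R(m+1) = 2R(m) + N^13, and the mistake
-- bound solves T(m+1) = 2T(m) + 2 with T(0) = 1. Every failure passes the known nodes of a
-- candidate set up to S.
theorem findDistinctLabel_spec (hG : G.Connected) (hall : ∀ v, v ∈ nodes)
    (hnodes : nodes.Nodup) (hN : Fintype.card V + 16 ≤ N) (hy : IsConvexLabeling G y) (m : ℕ)
    {S : List V} (hS : S.Nodup) {Z : List L} (hZ : Z.Nodup) (hm : Z.length = m + 1)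
    (hZN : Z.length + 16 ≤ N) {known : List (V × L)} (hk : IsValidKnowledge y known) :
    Spec G y (findDistinctLabel nodes m S Z) known ((2 ^ (m + 1) - 1) * N ^ 13) (3 * 2 ^ m - 2)
      (IsOutcome G y m S Z) := by
  have hnN := length_le_of_nodup hN hnodes
  induction m generalizing S Z known with
  | zero =>
    obtain ⟨z, rfl⟩ := List.length_eq_one_iff.1 hm
    refine (findOther_spec hN z S hk).mono ?_ (by norm_num) fun r known' h => ?_
    · have hSN := length_le_of_nodup hN hS
      have h1 := sixteen_mul_pow_le (N := N) (i := 3) (j := 13) (by omega) (by omega)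
      have h2 : 1 ≤ N ^ 2 := Nat.one_le_pow _ _ (by omega)
      have h3 : 1 ≤ N ^ 3 := Nat.one_le_pow _ _ (by omega)
      calc _ ≤ N * (2 * N ^ 2) + 1 := by gcongr <;> omega
        _ = 2 * N ^ 3 + 1 := by ring
        _ ≤ _ := by simp; omega
    · obtain _ | ⟨v, l⟩ := r
      · exact (HasKnownPart.of_forall hS h).mono (by simp)
      · exact ⟨h.1, h.2.1, by simpa using h.2.2⟩
  | succ m ih =>
    obtain _ | ⟨z, Z'⟩ := Z
    · simp at hm
    set Z := z :: Z' with hZdef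
    set R := (2 ^ (m + 1) - 1) * N ^ 13 with hR
    have hSN := length_le_of_nodup hN hS
    have hfilter : ∀ i, i ∈ Z → (Z.filter fun j => !decide (j = i)).length = m + 1 :=
      fun i hi => length_filter_ne hZ (by omega) hi
    have hQlen : (quadrupleList S).length ≤ nodes.length ^ 4 :=
      (length_quadrupleList_le S).trans (Nat.pow_le_pow_left
        (List.Subperm.length_le (hS.subperm fun v _ => hall v)) 4)
    have hrec : ∀ {Y : List V} {i : L} {known : List (V × L)}, Y.Nodup → i ∈ Z →
        IsValidKnowledge y known →
        Spec G y (findDistinctLabel nodes m Y (Z.filter fun j => !decide (j = i))) known R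
          (3 * 2 ^ m - 2) (IsOutcome G y m Y (Z.filter fun j => !decide (j = i))) :=
      fun hY hi hk => ih hY (hZ.filter _) (hfilter _ hi) (by rw [hfilter _ hi]; omega) hk
    have hμ : (0 : ℝ) ≤ 3 * 2 ^ m - 2 := by
      have : (1 : ℝ) ≤ 2 ^ m := one_le_pow₀ (by norm_num)
      linarith
    -- A subcall only excludes the labels of Z other than i; the separate comparison with i upgrades
    -- this to exclusion from all of Z.
    have hnotmem : ∀ {v : V} {i : L}, y v ∉ (Z.filter fun j => !decide (j = i)) → y v ≠ i →
        y v ∉ Z := fun h hne hmem => h (List.mem_filter.2 ⟨hmem, by simpa using hne⟩)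
    set cD := N ^ 11 + ((Z.length * 2 + 1) + (R + (1 + 0))) with hcD
    set cC := N ^ 11 + ((S.length * (N ^ 2 + 1) + 1) + ((Z.length * 2 + 1) + cD)) with hcC
    set cB := (S.length + 1) ^ 2 + (N ^ 11 + ((Z.length * 2 + 1) + (R + (1 + cC)))) with hcB
    set cA := N ^ 2 + ((Z.length * 2 + 1) + cB) with hcA
    refine Spec.mono (c := N ^ 6 + (N ^ 12 + (((quadrupleList S).length + 1) +
      (((goodList G S).length + 1) + ((S.length + 1) + (1 + (N ^ 11 + cA)))))))
      -- Mistakes in order: the guess for a, the search for b, the scan for c, the search for d.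
      (μ := 1 + ((3 * 2 ^ m - 2) + (1 + (3 * 2 ^ m - 2)))) ?_ ?_ ?_ fun _ _ h => h
    · rw [findDistinctLabel]
      refine Spec.call_bind hk (Computes.quadruples hSN) ?_
      refine Spec.call_bind hk (Computes.goodQuadruples hG hall hnN hQlen) ?_
      refine Spec.call_bind hk (Computes.size _) ?_
      refine Spec.call_bind hk (Computes.size (goodList G S)) ?_
      refine Spec.call_bind hk (Computes.size _) ?_
      refine Spec.call_bind hk (a := goodDensity G S) (Computes.compute _) ?_
      obtain ⟨o, ho, hoS⟩ := computes_argmax (G := G) (y := y) hSN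
      refine Spec.call_bind hk ho ?_
      rcases hoS with ⟨rfl, hS0⟩ | ⟨a, ha, rfl, hmax⟩
      · refine Spec.pure hk _ ⟨∅, by simp, by simp, by simp [hS0]⟩ _ (by linarith)
      refine Spec.bind hk ((learn_spec hN hk a z).mono (μ' := 1) le_rfl
        (by split_ifs <;> norm_num) fun _ _ h => h) ?_
      rintro _ k1 hk1 - ⟨rfl, hak⟩
      refine Spec.call_bind hk1 (Computes.memLabel (y a) Z) ?_
      by_cases hya : y a ∈ Z
      swap
      · rw [decide_eq_false hya, if_neg (by simp)]
        exact Spec.pure hk1 _ ⟨ha, rfl, hya⟩ _ (by linarith)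
      rw [decide_eq_true hya, if_pos rfl]
      refine Spec.call_bind hk1 (Computes.pairsOf S) ?_
      refine Spec.call_bind hk1 (computes_firstCandidates hG hall hnN hSN a) ?_
      refine Spec.call_bind hk1 (Computes.removeLabel (y a) Z) ?_
      refine Spec.bind hk1 (hrec (hS.filter _) hya hk1) ?_
      rintro (_ | ⟨b, yb⟩) k2 hk2 hs2 hout2
      · have hout : IsOutcome G y (m + 1) S Z none k2 :=
          HasKnownPart.of_candidates hG hS ha (mem_keys_of_suffix hs2 hak)
            (List.filter_subset_self _) (fun hg => le_length_firstCandidates hS hg ha hmax) hout2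
        exact Spec.pure hk2 none hout _ (by linarith)
      obtain ⟨hb, rfl, hbZ⟩ := hout2
      refine Spec.call_bind hk2 (Computes.askEqLabel (y b) (y a)) ?_
      by_cases hab : y b = y a
      swap
      · rw [decide_eq_false hab, if_neg (by simp)]
        exact Spec.pure hk2 _ ⟨List.mem_of_mem_filter hb, rfl, hnotmem hbZ hab⟩ _ (by linarith)
      rw [decide_eq_true hab, if_pos rfl]
      refine Spec.call_bind hk2 (computes_secondCandidates hG hall hnN hSN a b) ?_
      have hlen2 : (secondCandidates G S a b).length ≤ S.length := List.length_filter_le _ _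
      refine Spec.bind hk2 ((findOther_spec hN (y a) (secondCandidates G S a b) hk2).mono
        (by gcongr) le_rfl fun _ _ h => h) ?_
      rintro (_ | ⟨c, yc⟩) k3 hk3 hs3 hout3
      -- A failed scan makes all of Y_ab known, more than the fraction δ^m needed.
      · have hout : IsOutcome G y (m + 1) S Z none k3 :=
          HasKnownPart.of_candidates hG hS ha (mem_keys_of_suffix (hs2.trans hs3) hak)
            (List.filter_subset_self _) (fun hg => le_length_secondCandidates hS hg ha hb)
            ((HasKnownPart.of_forall (hS.filter _) hout3).mono
              (mul_le_of_le_one_left (by positivity)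
                (pow_le_one₀ (shrinkFactor_pos hG).le (shrinkFactor_le_one hG))))
        exact Spec.pure hk3 none hout _ (by linarith)
      obtain ⟨hc, rfl, hca⟩ := hout3
      refine Spec.call_bind hk3 (Computes.memLabel (y c) Z) ?_
      by_cases hyc : y c ∈ Z
      swap
      · rw [decide_eq_false hyc, if_neg (by simp)]
        exact Spec.pure hk3 _ ⟨List.mem_of_mem_filter hc, rfl, hyc⟩ _ (by linarith)
      rw [decide_eq_true hyc, if_pos rfl]
      refine Spec.call_bind hk3 (computes_thirdCandidates hG hall hnN hSN a b c) ?_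
      refine Spec.call_bind hk3 (Computes.removeLabel (y c) Z) ?_
      rw [← add_zero (3 * 2 ^ m - 2 : ℝ)]
      refine Spec.bind hk3 (hrec (hS.filter _) hyc hk3) ?_
      rintro (_ | ⟨d, yd⟩) k4 hk4 hs4 hout4
      · have hout : IsOutcome G y (m + 1) S Z none k4 :=
          HasKnownPart.of_candidates hG hS ha (mem_keys_of_suffix (hs2.trans (hs3.trans hs4)) hak)
            (List.filter_subset_self _) (fun hg => le_length_thirdCandidates hS hg hc) hout4
        exact Spec.pure hk4 none hout _ le_rfl
      obtain ⟨hd, rfl, hdZ⟩ := hout4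
      refine Spec.call_bind hk4 (Computes.askEqLabel (y d) (y c)) ?_
      -- Here y(b) = y(a) ≠ y(c) and the quadruple is good, so y(d) = y(c) would contradict
      -- convexity: the last comparison of the algorithm never fails.
      have hdc : y d ≠ y c := fun hdc => hy.not_isGoodQuadruple hG hab hdc hca
        (goodQuadruple_eq_true.1 (List.mem_filter.1 hd).2)
      rw [decide_eq_false hdc, if_neg (by simp)]
      exact Spec.pure hk4 _ ⟨List.mem_of_mem_filter hd, rfl, hnotmem hdZ hdc⟩ _ le_rfl
    · have h1 : (2 ^ (m + 1 + 1) - 1) * N ^ 13 = 2 * R + N ^ 13 := by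
        have : 1 ≤ 2 ^ (m + 1) := Nat.one_le_two_pow
        rw [hR, show 2 ^ (m + 1 + 1) - 1 = 2 * (2 ^ (m + 1) - 1) + 1 by
          rw [pow_succ]; omega]
        ring
      have h2 : (quadrupleList S).length ≤ N ^ 4 :=
        (length_quadrupleList_le S).trans (Nat.pow_le_pow_left (by omega) 4)
      have h3 : (goodList G S).length ≤ (quadrupleList S).length := List.length_filter_le _ _
      rw [h1]
      exact findDistinctLabel_cost hSN hZN h2 (h3.trans h2)
    · rw [pow_succ]; linarith

end Learner

/-! ### Analysis of the main loop -/

/-- A bound on the number of calls of `FindDistinctLabel` when `u` nodes are left and each call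
removes at least a `δ` fraction of them. -/
noncomputable def roundBound (δ : ℝ) (u : ℕ) : ℝ := if u = 0 then 0 else Real.log u / δ + 1

theorem roundBound_nonneg {δ : ℝ} (hδ : 0 < δ) (u : ℕ) : 0 ≤ roundBound δ u := by
  unfold roundBound
  split_ifs
  · exact le_rfl
  · have := Real.log_natCast_nonneg u
    positivity

/-- From 1 - δ ≤ exp(-δ), one round lowers ln u by at least δ. The summand 1 in `roundBound` pays
for the round that empties the set. -/
theorem one_add_roundBound_le {δ : ℝ} (hδ : 0 < δ) {u u' : ℕ} (hu : u ≠ 0)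
    (h : (u' : ℝ) ≤ (1 - δ) * u) : 1 + roundBound δ u' ≤ roundBound δ u := by
  unfold roundBound
  rw [if_neg hu]
  have hlog := Real.log_natCast_nonneg u
  split_ifs with hu'
  · have : 0 ≤ Real.log u / δ := by positivity
    linarith
  · have h0 : (0 : ℝ) < u' := by exact_mod_cast Nat.pos_of_ne_zero hu'
    have h1 : (0 : ℝ) < u := by exact_mod_cast Nat.pos_of_ne_zero hu
    have h2 : (u' : ℝ) ≤ Real.exp (-δ) * u := by
      refine h.trans (mul_le_mul_of_nonneg_right ?_ h1.le)
      have := Real.add_one_le_exp (-δ)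
      linarith
    have h3 := Real.log_le_log h0 h2
    rw [Real.log_mul (Real.exp_ne_zero _) h1.ne', Real.log_exp] at h3
    have h4 : Real.log u' / δ + 1 ≤ Real.log u / δ := by
      rw [← le_sub_iff_add_le, div_le_iff₀ hδ, sub_mul, div_mul_cancel₀ _ hδ.ne']
      linarith
    linarith

namespace Learner

open Prog

variable {V L : Type} [DecidableEq V] [DecidableEq L] [Fintype V] {G : SimpleGraph V}
  [DecidableRel G.Adj] {y : V → L} {nodes : List V} {N : ℕ}

theorem mainLoop_cost {m u w : ℕ} (hN : 16 ≤ N) (hu : u + 16 ≤ N) (hw : w + 16 ≤ N) :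
    N ^ 6 + (N ^ 12 + ((2 ^ (m + 1) - 1) * N ^ 13 + (u * (w * 2 + 1 + 1 + 1) + 1))) ≤
      2 ^ (m + 1) * N ^ 13 := by
  have h1 : 1 ≤ 2 ^ (m + 1) := Nat.one_le_two_pow
  obtain ⟨r, hr⟩ := Nat.exists_eq_add_of_le h1
  have h2 : u * (w * 2 + 1 + 1 + 1) + 1 ≤ 3 * N ^ 2 :=
    calc _ ≤ N * (2 * N) + 1 := by gcongr <;> omega
      _ = 2 * N ^ 2 + 1 := by ring
      _ ≤ _ := by
        have : 1 ≤ N ^ 2 := Nat.one_le_pow _ _ (by omega)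
        omega
  have p1 := sixteen_mul_pow_le hN (i := 12) (j := 13) (by omega)
  have p2 := sixteen_mul_pow_le hN (i := 6) (j := 12) (by omega)
  have p3 := sixteen_mul_pow_le hN (i := 2) (j := 6) (by omega)
  rw [hr, Nat.add_sub_cancel_left, add_mul, one_mul]
  omega

/-- Invariant: `U` consists of exactly the nodes with unknown label. The potential `roundBound`
drops by at least 1 per round, and each round makes at most 3·2^m mistakes. -/
theorem mainLoop_spec (hG : G.Connected) (hall : ∀ v, v ∈ nodes)
    (hnodes : nodes.Nodup) (hN : Fintype.card V + 16 ≤ N) (hy : IsConvexLabeling G y) (m : ℕ)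
    {Z : List L} (hZ : Z.Nodup) (hm : Z.length = m + 1) (hZN : Z.length + 16 ≤ N)
    (hZall : ∀ l, l ∈ Z) (fuel U : List V) (hU : U.Nodup) (hfuel : U.length ≤ fuel.length)
    {known : List (V × L)} (hk : IsValidKnowledge y known)
    (hUk : ∀ v, v ∈ U ↔ v ∉ known.map Prod.fst) :
    Spec G y (mainLoop nodes Z m U fuel) known (fuel.length * (2 ^ (m + 1) * N ^ 13) + N ^ 13)
      (3 * 2 ^ m * roundBound ((shrinkFactor G : ℝ) ^ m) U.length) fun U' known' =>
        U'.length ≤ 2 * hadwigerNumber G + 1 ∧ ∀ v, v ∈ U' ∨ v ∈ known'.map Prod.fst := by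
  have hδ : (0 : ℝ) < (shrinkFactor G : ℝ) ^ m := by
    have := shrinkFactor_pos hG
    positivity
  have h13 : 1 ≤ N ^ 13 := Nat.one_le_pow _ _ (by omega)
  have hμ : 0 ≤ 3 * 2 ^ m * roundBound ((shrinkFactor G : ℝ) ^ m) U.length := by
    have := roundBound_nonneg hδ U.length
    positivity
  have hcover : ∀ v, v ∈ U ∨ v ∈ known.map Prod.fst := fun v => by
    rw [hUk]; exact (em _).symm
  induction fuel generalizing U known with
  | nil =>
    refine (Spec.call hk (Computes.compute U) ?_).mono (by simpa using h13) hμ fun _ _ h => h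
    simp only [List.length_nil, Nat.le_zero] at hfuel
    exact ⟨by omega, hcover⟩
  | cons f fuel ih =>
    have hUN := length_le_of_nodup hN hU
    have hnN := length_le_of_nodup hN hnodes
    have hQlen : (quadrupleList U).length ≤ nodes.length ^ 4 :=
      (length_quadrupleList_le U).trans (Nat.pow_le_pow_left
        (List.Subperm.length_le (hU.subperm fun v _ => hall v)) 4)
    set T := fuel.length * (2 ^ (m + 1) * N ^ 13) + N ^ 13 with hT
    have hcost := mainLoop_cost (m := m) (u := U.length) (w := Fintype.card V) (N := N)
      (by omega) hUN hN
    refine Spec.mono (c := N ^ 6 + (N ^ 12 + ((2 ^ (m + 1) - 1) * N ^ 13 +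
      (U.length * (Fintype.card V * 2 + 1 + 1 + 1) + 1 + T)))) ?_ ?_ le_rfl fun _ _ h => h
    swap
    · rw [List.length_cons, add_mul]
      omega
    rw [mainLoop]
    refine Spec.call_bind hk (Computes.quadruples hUN) ?_
    refine Spec.call_bind hk (a := goodList G U)
      (Computes.goodQuadruples hG hall hnN hQlen) ?_
    rcases hgood : goodList G U with _ | ⟨q, Q⟩
    · refine Spec.mono (c := 1) (μ := 0) (Spec.call hk (Computes.compute U) ?_) (by omega) hμ
        fun _ _ h => h
      exact ⟨length_le_of_goodList_eq_nil hG hU hgood, hcover⟩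
    have hU0 : U.length ≠ 0 := by
      intro h0
      rw [List.eq_nil_of_length_eq_zero h0] at hgood
      cases hgood
    have hround : (0 : ℝ) ≤ roundBound ((shrinkFactor G : ℝ) ^ m) U.length - 1 := by
      have := one_add_roundBound_le hδ (u := U.length) (u' := 0) hU0 ?_
      · have := roundBound_nonneg hδ 0
        linarith
      · have h1 : (shrinkFactor G : ℝ) ^ m ≤ 1 := pow_le_one₀
          (by exact_mod_cast (shrinkFactor_pos hG).le) (by exact_mod_cast shrinkFactor_le_one hG)
        rw [Nat.cast_zero]
        exact mul_nonneg (by linarith) (by positivity)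
    dsimp only
    rw [show 3 * 2 ^ m * roundBound ((shrinkFactor G : ℝ) ^ m) U.length = 3 * 2 ^ m +
      3 * 2 ^ m * (roundBound ((shrinkFactor G : ℝ) ^ m) U.length - 1) by ring]
    refine Spec.bind hk ((findDistinctLabel_spec hG hall hnodes hN hy m hU hZ hm hZN hk).mono
      le_rfl (by linarith) fun _ _ h => h) ?_
    rintro (_ | ⟨v, l⟩) k1 hk1 hs1 hout
    swap
    -- All labels belong to `Z`, so a node with a label outside `Z` cannot be returned.
    · exact absurd (hZall l) hout.2.2
    obtain ⟨T, hTU, hTk, hTc⟩ := hout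
    refine Spec.get_bind ?_
    set U' := U.filter fun v => (if v ∈ k1.map Prod.fst then some (y v) else none).isNone with hU'
    have hUk' : ∀ v, v ∈ U' ↔ v ∉ k1.map Prod.fst := fun v => by
      rw [hU', List.mem_filter, hUk]
      by_cases hv : v ∈ k1.map Prod.fst
      · simp only [hv, if_true]; simp
      · simp only [hv, if_false]
        simp [mt (mem_keys_of_suffix hs1) hv]
    have hU'nd : U'.Nodup := hU.filter _
    have hlen : U'.length + T.card ≤ U.length := by
      rw [← List.toFinset_card_of_nodup hU'nd, ← List.toFinset_card_of_nodup hU,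
        ← Finset.card_union_of_disjoint]
      · refine Finset.card_le_card (Finset.union_subset (fun v hv => ?_) hTU)
        rw [List.mem_toFinset] at hv ⊢
        exact List.mem_of_mem_filter hv
      · rw [Finset.disjoint_left]
        intro v hv hvT
        exact (hUk' v).1 (List.mem_toFinset.1 hv) (hTk v hvT)
    -- The revealed fraction is positive, so at least one node leaves `U` and the fuel suffices.
    have hTpos : 0 < T.card := by
      have h1 : (0 : ℚ) < shrinkFactor G ^ m * U.length := by
        have := shrinkFactor_pos hG
        have : (0 : ℚ) < U.length := by exact_mod_cast Nat.pos_of_ne_zero hU0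
        positivity
      exact_mod_cast h1.trans_le hTc
    have hlen' : (U'.length : ℝ) ≤ (1 - (shrinkFactor G : ℝ) ^ m) * U.length := by
      have h1 : (U'.length : ℝ) + T.card ≤ U.length := by exact_mod_cast hlen
      have h2 : (shrinkFactor G : ℝ) ^ m * U.length ≤ T.card := by exact_mod_cast hTc
      linarith
    refine Spec.call_bind hk1 (a := U') ((Computes.filterIn fun v _ =>
      ((Computes.lookup hk1.eq_label v).bind (f := fun o => compute o.isNone)
        (Computes.compute _)).mono
        (c' := Fintype.card V * 2 + 1 + 1) ?_)) ?_
    · have := hk1.length_le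
      omega
    have hr := one_add_roundBound_le hδ hU0 hlen'
    refine (ih U' hU'nd ?_ hk1 hUk' ?_ fun v => ?_).mono le_rfl ?_ fun _ _ h => h
    · rw [List.length_cons] at hfuel; omega
    · have := roundBound_nonneg hδ U'.length
      positivity
    · rw [hUk']; exact (em _).symm
    · gcongr
      linarith

end Learner

/-! ### The theorem -/

section Final

open Prog Learner

variable {V L : Type} [DecidableEq V] [DecidableEq L] {G : SimpleGraph V}
  [DecidableRel G.Adj] {y : V → L}

/-- The part of the algorithm after counting the labels. -/
def multiclassGood4Learner (nodes : List V) (z : L) (Z : List L) (m : ℕ) : Learner V L Unit :=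
  mainLoop nodes (z :: Z) m nodes nodes >>= fun U => predictAll z U

theorem exec_multiclassGood4 (nodes : List V) (z : L) (Z : List L) :
    ((multiclassGood4 nodes (z :: Z)).exec G y).result =
        ((multiclassGood4Learner nodes z Z Z.length []).exec G y).result.2 ∧
      ((multiclassGood4 nodes (z :: Z)).exec G y).steps ≤
        Z.length + 1 + ((multiclassGood4Learner nodes z Z Z.length []).exec G y).steps ∧
      ((multiclassGood4 nodes (z :: Z)).exec G y).trials =
        ((multiclassGood4Learner nodes z Z Z.length []).exec G y).trials := by
  have hsize := Computes.size (G := G) (y := y) Z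
  set P : ℕ → Prog V L (List (V × L)) := fun m =>
    (mainLoop nodes (z :: Z) m nodes nodes []).seq fun r =>
      (predictAll z r.1 r.2).seq fun s => .done s.2 with hP
  have e1 := exec_seq G y (Prog.size Z) P
  change (multiclassGood4 nodes (z :: Z)).exec G y = _ at e1
  rw [hsize.result, hsize.trials, List.nil_append] at e1
  have e2 := exec_seq G y (mainLoop nodes (z :: Z) Z.length nodes nodes []) fun r =>
    (predictAll z r.1 r.2).seq fun s => .done s.2
  have e3 := exec_seq G y (mainLoop nodes (z :: Z) Z.length nodes nodes []) fun r =>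
    predictAll z r.1 r.2
  change (multiclassGood4Learner nodes z Z Z.length []).exec G y = _ at e3
  rw [e1, e3]
  simp only [hP, e2, exec_seq, exec, add_zero, List.append_nil, true_and, and_true]
  have := hsize.steps_le
  omega

variable [Fintype V]

theorem multiclassGood4Learner_spec (hG : G.Connected) {nodes : List V} (hall : ∀ v, v ∈ nodes)
    (hnodes : nodes.Nodup) (hy : IsConvexLabeling G y) {z : L} {Z : List L} {m : ℕ}
    (hm : Z.length = m)
    (hZ : (z :: Z).Nodup) (hZall : ∀ l, l ∈ z :: Z) {N : ℕ} (hN : Fintype.card V + 16 ≤ N)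
    (hZN : (z :: Z).length + 16 ≤ N) :
    Spec G y (multiclassGood4Learner nodes z Z m) []
      (nodes.length * (2 ^ (m + 1) * N ^ 13) + N ^ 13 +
        ((2 * hadwigerNumber G + 1) * N ^ 2 + 1))
      (3 * 2 ^ m * roundBound ((shrinkFactor G : ℝ) ^ m) nodes.length +
        (2 * hadwigerNumber G + 1)) fun _ known => ∀ v, v ∈ known.map Prod.fst := by
  subst hm
  have hk : IsValidKnowledge y ([] : List (V × L)) := ⟨List.nodup_nil, by simp⟩
  refine Spec.bind hk (mainLoop_spec hG hall hnodes hN hy _ hZ rfl hZN hZall nodes nodes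
    hnodes le_rfl hk (by simpa using hall)) fun U known hk' _ hU => ?_
  refine (predictAll_spec hN z U hk').mono ?_ ?_ fun _ _ h v => h v (hU.2 v)
  · gcongr
    exact hU.1
  · exact_mod_cast hU.1

/-! ### Final estimates and assembly -/

theorem multiclassGood4_steps_bound {n m h : ℕ} (hn : 1 ≤ n) (hh : h ≤ n) :
    m + 1 + (n * (2 ^ (m + 1) * (n + (m + 1) + 16) ^ 13) + (n + (m + 1) + 16) ^ 13 +
      ((2 * h + 1) * (n + (m + 1) + 16) ^ 2 + 1)) ≤ (2 * 36 ^ 15) ^ (m + 1) * n ^ 15 := by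
  set N := n + (m + 1) + 16 with hN
  have hN16 : 16 ≤ N := by omega
  have h1 : 1 ≤ 2 ^ (m + 1) := Nat.one_le_two_pow
  have h2 : n * (2 ^ (m + 1) * N ^ 13) ≤ 2 ^ (m + 1) * N ^ 14 :=
    calc _ ≤ N * (2 ^ (m + 1) * N ^ 13) := by gcongr; omega
      _ = _ := by ring
  have h3 : (2 * h + 1) * N ^ 2 ≤ 2 * N ^ 3 :=
    calc _ ≤ (2 * N) * N ^ 2 := by gcongr; omega
      _ = _ := by ring
  have h4 : ∀ x, x ≤ 2 ^ (m + 1) * x := fun x => Nat.le_mul_of_pos_left x h1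
  have p1 := sixteen_mul_pow_le hN16 (i := 14) (j := 15) (by omega)
  have p2 := sixteen_mul_pow_le hN16 (i := 13) (j := 14) (by omega)
  have p3 := sixteen_mul_pow_le hN16 (i := 3) (j := 13) (by omega)
  have p4 := sixteen_mul_pow_le hN16 (i := 1) (j := 3) (by omega)
  rw [pow_one] at p4
  have h5 : m + 1 + (n * (2 ^ (m + 1) * N ^ 13) + N ^ 13 + ((2 * h + 1) * N ^ 2 + 1)) ≤
      2 ^ (m + 1) * N ^ 15 := by
    have h6 : 2 ^ (m + 1) * (16 * N ^ 14) ≤ 2 ^ (m + 1) * N ^ 15 := Nat.mul_le_mul_left _ p1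
    have h7 := h4 (N ^ 14)
    rw [mul_left_comm] at h6
    omega
  -- N ≤ 18(m+1)n, and both 18 and m + 1 are absorbed exponentially: 36 = 18·2.
  have h8 : N ≤ 36 ^ (m + 1) * n := by
    have h9 : m + 1 < 2 ^ (m + 1) := Nat.lt_two_pow_self
    have h10 : 18 ≤ 18 ^ (m + 1) := Nat.le_self_pow (by omega) 18
    calc N ≤ (18 * (m + 1)) * n := by rw [hN]; nlinarith
      _ ≤ (18 ^ (m + 1) * 2 ^ (m + 1)) * n := by gcongr
      _ = _ := by rw [← mul_pow]; norm_num
  calc _ ≤ 2 ^ (m + 1) * N ^ 15 := h5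
    _ ≤ 2 ^ (m + 1) * (36 ^ (m + 1) * n) ^ 15 := by gcongr
    _ = _ := by rw [mul_pow, mul_pow, ← pow_mul, ← pow_mul, mul_comm (m + 1) 15, mul_assoc]

/-- With X = 8192^m 2^m h^(4(m+1)) ln n, the logarithmic part of the rounds costs at most 3X, the
extra round 6X and the leftover nodes 6X, the last two because ln n ≥ 1/2. The total 15X explains
122880 = 15·8192. For m = 0 the term 2h + 1 is covered by the spare factor h^4 in X. -/
theorem multiclassGood4_mistakes_bound {V : Type} [Fintype V] {G : SimpleGraph V} (hG : G.Connected) (hn : 2 ≤ Fintype.card V) (m : ℕ) :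
    3 * 2 ^ m * roundBound ((shrinkFactor G : ℝ) ^ m) (Fintype.card V) +
        (2 * hadwigerNumber G + 1) ≤
      (122880 : ℝ) ^ (m + 1) * (2 ^ (m + 1) * (hadwigerNumber G : ℝ) ^ (4 * (m + 1)) *
        Real.log (Fintype.card V)) := by
  have hh : (1 : ℝ) ≤ hadwigerNumber G := by exact_mod_cast one_le_hadwigerNumber hG
  set h := (hadwigerNumber G : ℝ) with hh0
  set ℓ := Real.log (Fintype.card V) with hl
  have hℓ : 1 / 2 ≤ ℓ := by
    have h1 : Real.log 2 ≤ ℓ := Real.log_le_log (by norm_num) (by exact_mod_cast hn)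
    have := Real.log_two_gt_d9
    linarith
  have hδ : (shrinkFactor G : ℝ) = (8192 * h ^ 4)⁻¹ := by
    rw [shrinkFactor, one_div]
    push_cast
    rfl
  rw [roundBound, if_neg (by omega), hδ, inv_pow, div_inv_eq_mul, mul_pow, ← pow_mul]
  set H := h ^ (4 * (m + 1)) with hH
  have h1 : h ^ (4 * m) ≤ H := pow_le_pow_right₀ hh (by omega)
  have h2 : h ≤ H := le_self_pow₀ hh (by omega)
  have hA : (1 : ℝ) ≤ 8192 ^ m := one_le_pow₀ (by norm_num)
  have hB : (1 : ℝ) ≤ 2 ^ m := one_le_pow₀ (by norm_num)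
  have h15 : (15 : ℝ) ≤ 15 ^ (m + 1) := le_self_pow₀ (by norm_num) (by omega)
  have hHl : 0 ≤ H * ℓ := by positivity
  have hAB : (1 : ℝ) ≤ 8192 ^ m * 2 ^ m := one_le_mul_of_one_le_of_one_le hA hB
  have e1 : (2 : ℝ) ^ m * (ℓ * (8192 ^ m * h ^ (4 * m))) ≤ (8192 ^ m * 2 ^ m) * (H * ℓ) :=
    calc _ ≤ (2 : ℝ) ^ m * (ℓ * (8192 ^ m * H)) := by gcongr
      _ = _ := by ring
  have e2 : (1 : ℝ) ≤ 2 * (H * ℓ) := by nlinarith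
  have e3 : (2 : ℝ) ^ m ≤ 2 * ((8192 ^ m * 2 ^ m) * (H * ℓ)) :=
    calc (2 : ℝ) ^ m = 1 * 2 ^ m * 1 := by ring
      _ ≤ (8192 ^ m) * 2 ^ m * (2 * (H * ℓ)) := by gcongr
      _ = _ := by ring
  have e4 : 2 * h + 1 ≤ 6 * ((8192 ^ m * 2 ^ m) * (H * ℓ)) :=
    calc 2 * h + 1 ≤ 3 * (1 * (H * 1)) := by linarith
      _ ≤ 3 * ((8192 ^ m * 2 ^ m) * (H * (2 * ℓ))) := by gcongr; linarith
      _ = _ := by ring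
  calc _ = 3 * ((2 : ℝ) ^ m * (ℓ * (8192 ^ m * h ^ (4 * m)))) + 3 * 2 ^ m + (2 * h + 1) := by ring
    _ ≤ 15 * ((8192 ^ m * 2 ^ m) * (H * ℓ)) := by linarith
    _ ≤ 15 ^ (m + 1) * ((8192 ^ (m + 1) * 2 ^ (m + 1)) * (H * ℓ)) := by
        gcongr <;> norm_num
    _ = _ := by
        rw [show (122880 : ℝ) = 15 * 8192 by norm_num, mul_pow]
        ring

end Final

theorem mainTheorem3 :
    ∃ C d : ℕ, ∀ (k : ℕ) (V : Type) [Fintype V] [DecidableEq V]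
      (G : SimpleGraph V) [DecidableRel G.Adj], G.Connected →
      ∀ nodes : List V, nodes.Nodup → (∀ v, v ∈ nodes) →
      ∀ y : V → Fin k, IsConvexLabeling G y →
        -- every node is selected in exactly one trial, and all labels are restored
        ((((multiclassGood4 nodes (List.finRange k)).exec G y).trials.map Prod.fst).Perm nodes ∧
          ((multiclassGood4 nodes (List.finRange k)).exec G y).result.Perm
            (nodes.map fun v => (v, y v))) ∧
        -- the running time is polynomial in the number of nodes
        ((multiclassGood4 nodes (List.finRange k)).exec G y).steps ≤ C ^ k * Fintype.card V ^ d ∧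
        -- the number of mistakes
        (2 ≤ Fintype.card V →
          (((multiclassGood4 nodes (List.finRange k)).exec G y).mistakes y : ℝ) ≤
            (C : ℝ) ^ k *
              (2 ^ k * (hadwigerNumber G : ℝ) ^ (4 * k) * Real.log (Fintype.card V))) := by
  refine ⟨2 * 36 ^ 15, 15, fun k V _ _ G _ hG nodes hnodes hall y hy => ?_⟩
  have hcard : nodes.length = Fintype.card V :=
    le_antisymm hnodes.length_le_card (by
      rw [← Finset.card_univ, ← List.toFinset_card_of_nodup hnodes]
      exact Finset.card_le_card fun v _ => List.mem_toFinset.2 (hall v))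
  have hpos : 1 ≤ Fintype.card V := Fintype.card_pos_iff.2 hG.nonempty
  -- There is no labeling with k = 0, since a connected graph has a node.
  obtain _ | m := k
  · obtain ⟨v⟩ := hG.nonempty
    exact (y v).elim0
  have hZ : (List.finRange (m + 1)).Nodup := List.nodup_finRange _
  have hZall : ∀ l : Fin (m + 1), l ∈ List.finRange (m + 1) := List.mem_finRange
  have hlen : (List.finRange (m + 1)).length = m + 1 := List.length_finRange
  generalize List.finRange (m + 1) = labels at hZ hZall hlen
  obtain _ | ⟨z, Z⟩ := labels
  · simp at hlen
  have hm : Z.length = m := by simpa using hlen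
  obtain ⟨hres, hsteps, htrials⟩ := exec_multiclassGood4 (G := G) (y := y) nodes z Z
  rw [hm] at hres hsteps htrials
  have hspec := multiclassGood4Learner_spec hG hall hnodes hy hm hZ hZall
    (N := Fintype.card V + (m + 1) + 16) (by omega) (by omega)
  set e := (multiclassGood4 nodes (z :: Z)).exec G y with he
  set e' := (multiclassGood4Learner nodes z Z m []).exec G y with he'
  have hknown := hspec.known_eq
  rw [List.append_nil] at hknown
  have hkeys : e'.result.2.map Prod.fst = (e.trials.map Prod.fst).reverse := by
    rw [hknown, htrials, List.map_reverse, List.map_map]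
    rfl
  have hperm : (e.trials.map Prod.fst).Perm nodes := by
    -- The selected nodes are, in reverse, the recorded ones; these are distinct and exhaust all
    -- nodes, so each is selected exactly once.
    refine (List.reverse_perm _).symm.trans ?_
    rw [← hkeys, List.perm_ext_iff_of_nodup hspec.nodup hnodes]
    exact fun v => iff_of_true (hspec.post v) (hall v)
  refine ⟨⟨hperm, ?_⟩, ?_, fun hn => ?_⟩
  · rw [hres, hknown]
    refine (List.reverse_perm _).trans ?_
    have := hperm.map fun v => (v, y v)
    rwa [htrials, List.map_map] at this
  · refine hsteps.trans ((Nat.add_le_add_left hspec.steps_le _).trans ?_)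
    rw [hcard]
    exact multiclassGood4_steps_bound hpos hadwigerNumber_le_card
  · have h1 : e.mistakes y = e'.mistakes y := by
      rw [Execution.mistakes, Execution.mistakes, htrials]
    rw [h1]
    refine hspec.mistakes_le.trans ?_
    rw [hcard]
    refine (multiclassGood4_mistakes_bound hG hn m).trans ?_
    gcongr
    norm_num
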